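/- For a finite simple graph $G=(V,E)$ and a stable set $S\subseteq V$, let $$\mathrm{val}(S)=\min_{f\in V\cup\{\emptyset\}}\ \max_{e}\ |S-f+e| ,$$ where the maximum is over all $e\in (V\setminus(S+f))\cup\{\emptyset\}$ for which $S-f+e$ is a stable set ($\emptyset$ means that no vertex is deleted, respectively added). Unweighted Robust Stable Set asks for an optimal first-stage solution, i.e. a stable set $S$ that maximizes $\mathrm{val}(S)$. A stable set $S$ is repairable if for each $f\in S$ there is an $e\in V\setminus S$ such that $S-f+e$ is a stable set. Theorem 5.1. Unweighted Robust Stable Set is solvable in polynomial time on bipartite graphs. More precisely: (a) Let $G$ be a finite bipartite graph. Every repairable maximum stable set of $G$ is an optimal first-stage solution. If $G$ has no repairable maximum stable set, then every maximum stable set of $G$ is an optimal first-stage solution. (b) There is an algorithm that, given a bipartite graph $G$ with vertices $0,\dots,n-1$ ($n$ in unary followed by the adjacency matrix), outputs in a number of steps polynomial in the input length the characteristic vector of an optimal first-stage solution which is a maximum stable set of $G$ and which is repairable whenever $G$ has a repairable maximum stable set. Here an algorithm is a program of a random access machine with addition and truncated subtraction, at unit cost. -/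

import Mathlib

/-!
## A random access machine with a step count

Registers `0, 1, 2, …` are addressed directly, memory cells only through the contents of a
register.  The arithmetic operations are addition and truncated subtraction (no multiplication), so
that after `t` steps the numbers have at most `t` bits more than the initial ones and the constants
in the program, and unit cost is polynomially equivalent to the running time of a Turing machine.
-/

/-- A state of the machine: the contents of the registers and of the memory cells. -/
structure RAMState where
  reg : ℕ → ℕ
  mem : ℕ → ℕ

/-- Assign the value `a` to register `x`. -/
def RAMState.setReg (s : RAMState) (x a : ℕ) : RAMState :=
  { s with reg := Function.update s.reg x a }

/-- Assign the value `a` to memory cell `i`. -/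
def RAMState.setMem (s : RAMState) (i a : ℕ) : RAMState :=
  { s with mem := Function.update s.mem i a }

/-- Structured programs for the random access machine; `x y z` are indices of registers. -/
inductive RAMProgram : Type
  /-- do nothing -/
  | skip : RAMProgram
  /-- `x := c` for a constant `c` -/
  | const (x c : ℕ) : RAMProgram
  /-- `x := y + z` -/
  | add (x y z : ℕ) : RAMProgram
  /-- `x := max (y - z) 0` -/
  | sub (x y z : ℕ) : RAMProgram
  /-- `x := mem[y]` -/
  | load (x y : ℕ) : RAMProgram
  /-- `mem[x] := y` -/
  | store (x y : ℕ) : RAMProgram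
  /-- `P` and then `Q` -/
  | seq (P Q : RAMProgram) : RAMProgram
  /-- if register `x` is nonzero then `P` else `Q` -/
  | cond (x : ℕ) (P Q : RAMProgram) : RAMProgram
  /-- while register `x` is nonzero do `P` -/
  | loop (x : ℕ) (P : RAMProgram) : RAMProgram

/-- `RAMProgram.Runs P s t s'`: started in the state `s`, the program `P` halts after exactly `t`
steps in the state `s'`.  Every elementary instruction and every test of a condition is one step. -/
inductive RAMProgram.Runs : RAMProgram → RAMState → ℕ → RAMState → Prop
  | skip (s : RAMState) : Runs .skip s 1 s
  | const (s : RAMState) (x c : ℕ) : Runs (.const x c) s 1 (s.setReg x c)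
  | add (s : RAMState) (x y z : ℕ) : Runs (.add x y z) s 1 (s.setReg x (s.reg y + s.reg z))
  | sub (s : RAMState) (x y z : ℕ) : Runs (.sub x y z) s 1 (s.setReg x (s.reg y - s.reg z))
  | load (s : RAMState) (x y : ℕ) : Runs (.load x y) s 1 (s.setReg x (s.mem (s.reg y)))
  | store (s : RAMState) (x y : ℕ) : Runs (.store x y) s 1 (s.setMem (s.reg x) (s.reg y))
  | seq {P Q : RAMProgram} {s s' s'' : RAMState} {t t' : ℕ} :
      Runs P s t s' → Runs Q s' t' s'' → Runs (.seq P Q) s (t + t') s''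
  | cond_true {x : ℕ} {P Q : RAMProgram} {s s' : RAMState} {t : ℕ} :
      s.reg x ≠ 0 → Runs P s t s' → Runs (.cond x P Q) s (1 + t) s'
  | cond_false {x : ℕ} {P Q : RAMProgram} {s s' : RAMState} {t : ℕ} :
      s.reg x = 0 → Runs Q s t s' → Runs (.cond x P Q) s (1 + t) s'
  | loop_done {x : ℕ} {P : RAMProgram} {s : RAMState} :
      s.reg x = 0 → Runs (.loop x P) s 1 s
  | loop_step {x : ℕ} {P : RAMProgram} {s s' s'' : RAMState} {t t' : ℕ} :
      s.reg x ≠ 0 → Runs P s t s' → Runs (.loop x P) s' t' s'' →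
      Runs (.loop x P) s (1 + t + t') s''

/-- The initial state on the input word `w`: register `0` holds the length of `w`, memory cell `i`
holds the `i`-th bit of `w`, and everything else is `0`. -/
def RAMState.ofInput (w : List Bool) : RAMState where
  reg x := if x = 0 then w.length else 0
  mem i := if w.getD i false = true then 1 else 0

/-- The output word of a final state: register `0` holds its length, and its `i`-th bit is `1` if and
only if memory cell `i` is nonzero. -/
def RAMState.output (s : RAMState) : List Bool :=
  (List.range (s.reg 0)).map fun i => decide (s.mem i ≠ 0)

/-- A search problem with instances `a : α`, candidate solutions `b : β a` and correct solutions
`Sol a b`, whose instances and solutions are written as binary words by `encIn` and `encOut`, is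
solvable in polynomial time: a single program finds, for every instance, a correct solution, within
a number of steps (reading off the output included) that is polynomial in the input length. -/
def PolyTimeSolvable {α : Type} {β : α → Type} (encIn : α → List Bool)
    (encOut : (a : α) → β a → List Bool) (Sol : (a : α) → β a → Prop) : Prop :=
  ∃ (P : RAMProgram) (p : Polynomial ℕ), ∀ a : α, ∃ (b : β a) (t : ℕ) (s : RAMState),
    P.Runs (RAMState.ofInput (encIn a)) t s ∧ s.output = encOut a b ∧
      t + (encOut a b).length ≤ p.eval (encIn a).length ∧ Sol a b

/-! ## Recoverable robust optimization with commitment, unit weights -/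

section Robust

variable {E : Type*} [Fintype E] [DecidableEq E]

/-- `S - f + e`, where `f` and `e` are elements or nothing. -/
def secondStage (S : Finset E) (f e : Option E) : Finset E :=
  (S \ f.toFinset) ∪ e.toFinset

open Classical in
/-- The admissible recourse actions when `S` has been chosen and `f` has been deleted: nothing, or an
element outside `S + f`, such that the resulting second-stage solution is feasible. -/
noncomputable def recourses (F : Finset E → Prop) (S : Finset E) (f : Option E) :
    Finset (Option E) :=
  Finset.univ.filter fun e => Disjoint e.toFinset (S ∪ f.toFinset) ∧ F (secondStage S f e)

/-- The worst-case cardinality of the second-stage solution when `S` is the first-stage solution: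
the minimum over all interdictions `f` (an element or nothing) of the maximum over all admissible
recourse actions `e` of `|S - f + e|`. -/
noncomputable def robustValue (F : Finset E → Prop) (S : Finset E) : ℕ :=
  Finset.univ.inf' Finset.univ_nonempty fun f : Option E =>
    (recourses F S f).sup fun e => (secondStage S f e).card

/-- `S` is an optimal first-stage solution of the unweighted robust problem with feasible sets
`F`. -/
def IsRobustOptimal (F : Finset E → Prop) (S : Finset E) : Prop :=
  F S ∧ ∀ T : Finset E, F T → robustValue F T ≤ robustValue F S

/-- The feasible set `S` is repairable. -/
def IsRepairable (F : Finset E → Prop) (S : Finset E) : Prop :=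
  F S ∧ ∀ f ∈ S, ∃ e, e ∉ S ∧ F (insert e (S.erase f))

end Robust

/-! ## Stable sets in graphs -/

/-- `S` is a stable set of `G`. -/
def IsStable {V : Type*} (G : SimpleGraph V) (S : Finset V) : Prop :=
  G.IsIndepSet (S : Set V)

/-- `S` is a stable set of `G` of maximum cardinality that is repairable. -/
def IsRepairableMaximumStable {V : Type*} [Fintype V] [DecidableEq V] (G : SimpleGraph V)
    (S : Finset V) : Prop :=
  G.IsMaximumIndepSet S ∧ IsRepairable (IsStable G) S

/-- The finite bipartite graphs, with vertices `0, …, n - 1`, as instances of a computational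
problem. -/
structure BipartiteInstance : Type where
  n : ℕ
  graph : SimpleGraph (Fin n)
  bipartite : graph.IsBipartite

open Classical in
/-- The input word of a graph: `n` in unary (`n` ones and a zero), and then the `n * n` entries of
the adjacency matrix, row by row. -/
noncomputable def BipartiteInstance.code (I : BipartiteInstance) : List Bool :=
  List.replicate I.n true ++ false ::
    (List.finRange I.n).flatMap fun i => (List.finRange I.n).map fun j => decide (I.graph.Adj i j)

/-- The characteristic vector of a set of vertices, as a binary word. -/
def vertexSetCode {n : ℕ} (S : Finset (Fin n)) : List Bool :=
  (List.finRange n).map fun i => decide (i ∈ S)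

/-! Let α be the maximum size of a stable set. The interdiction that deletes nothing shows that no
value exceeds α. Answering every deletion with nothing shows that a maximum stable set has value at
least α - 1, and repairability lifts this to α. Conversely, a stable set of value α yields a
repairable maximum stable set (`robustValue_le_card_sub_one`). Hence a repairable maximum stable set
is optimal, and if there is none, every maximum stable set is.

It remains to recognise when a bipartite graph has a repairable maximum stable set T. Both colour
classes are stable, so the complement of T is no larger than T. The repair map f ↦ e is injective
from T to the complement, hence bijective, and each f in T is a leaf hanging on its own vertex e
(`IsRepairableMaximumStable.exists_matching`). Only components that are single edges leave a choice
of leaf; taking the smaller end there gives a canonical candidate, the chosen leaves. A repairable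
maximum stable set exists if and only if every other vertex has exactly one chosen neighbour, and
then the chosen leaves form one (`isRepairableMaximumStable_of_isChosenLeaf`,
`IsRepairableMaximumStable.existsUnique_isChosenLeaf`).

If this test fails, any maximum stable set will do. After a two-colouring, an auction computes one:
an unmatched vertex of colour 1 takes a neighbour of least label, evicts its partner and raises the
label by one, as long as that label is at most n. The n labels miss some K in 1, …, n + 1, and
cutting at K gives a stable set into which its complement is matched
(`isMaximumIndepSet_of_labels`).

For the running time, all of this is written as an array program whose loops run L = n² + n + 1
times, L being the input length. Structural induction compiles such programs to the machine with a
polynomial step bound (`ArrayExpr.exists_program`, `ArrayProgram.exists_program`). L rounds suffice: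
colouring needs n, and the labels of the auction sum to at most n(n + 1) < L. -/

/-! ## Array programs

A small language of programs on arrays of length `L`, where `L` is the length of the input word.
Expressions have bounded sums, and all loops run `L` times, so that every program runs in
polynomial time on the random access machine. -/

/-- Expressions over the input, the arrays and the variables. -/
inductive ArrayExpr : Type
  | const (c : ℕ) : ArrayExpr
  | var (x : ℕ) : ArrayExpr
  | input (e : ArrayExpr) : ArrayExpr
  | read (a : ℕ) (e : ArrayExpr) : ArrayExpr
  | add (e f : ArrayExpr) : ArrayExpr
  | sub (e f : ArrayExpr) : ArrayExpr
  | cond (c e f : ArrayExpr) : ArrayExpr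
  | sum (x : ℕ) (e : ArrayExpr) : ArrayExpr

/-- The value of an expression on the input `w`, with arrays `σ` and variables `ρ`. -/
def ArrayExpr.eval (w : List Bool) (σ : ℕ → ℕ → ℕ) : ArrayExpr → (ℕ → ℕ) → ℕ
  | const c, _ => c
  | var x, ρ => ρ x
  | input e, ρ => (RAMState.ofInput w).mem (e.eval w σ ρ)
  | read a e, ρ => if e.eval w σ ρ < w.length then σ a (e.eval w σ ρ) else 0
  | add e f, ρ => e.eval w σ ρ + f.eval w σ ρ
  | sub e f, ρ => e.eval w σ ρ - f.eval w σ ρ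
  | cond c e f, ρ => if c.eval w σ ρ ≠ 0 then e.eval w σ ρ else f.eval w σ ρ
  | sum x e, ρ => ∑ j ∈ Finset.range w.length, e.eval w σ (Function.update ρ x j)

/-- Array programs: assignment of an expression to all entries of an array at once, sequential
composition, and repetition as often as the input is long. -/
inductive ArrayProgram : Type
  | assign (a : ℕ) (e : ArrayExpr) : ArrayProgram
  | seq (P Q : ArrayProgram) : ArrayProgram
  | rep (P : ArrayProgram) : ArrayProgram

/-- The arrays after the run of a program; in the expression of an assignment, every variable is the
index of the entry. -/
def ArrayProgram.eval (w : List Bool) : ArrayProgram → (ℕ → ℕ → ℕ) → ℕ → ℕ → ℕ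
  | assign a e, σ => Function.update σ a fun i => e.eval w σ fun _ => i
  | seq P Q, σ => Q.eval w (P.eval w σ)
  | rep P, σ => (P.eval w)^[w.length] σ

/-! ### Compiling array programs to the random access machine -/

/-- The state `s` of the random access machine represents the arrays `σ`: the array `a` occupies
block `a + 2` of the memory, blocks having the length of the input. -/
structure Represents (w : List Bool) (σ : ℕ → ℕ → ℕ) (s : RAMState) : Prop where
  len : s.reg 0 = w.length
  input : ∀ i < w.length, s.mem i = (RAMState.ofInput w).mem i
  array : ∀ a, ∀ i < w.length, s.mem (i + (a + 2) * w.length) = σ a i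

theorem Represents.congr {w : List Bool} {σ : ℕ → ℕ → ℕ} {s s' : RAMState} {k : ℕ} (hk : 0 < k)
    (h : Represents w σ s) (hm : s'.mem = s.mem) (hr : ∀ r < k, s'.reg r = s.reg r) :
    Represents w σ s' :=
  ⟨by rw [hr 0 hk, h.len], by rw [hm]; exact h.input, by rw [hm]; exact h.array⟩

namespace RAMProgram

/-- A loop whose body maintains an invariant that is indexed by the value of the counter. -/
theorem exists_runs_loop {x : ℕ} {P : RAMProgram} {T : ℕ} (I : ℕ → RAMState → Prop)
    (hx : ∀ j s, I j s → s.reg x = j)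
    (hP : ∀ j s, I (j + 1) s → ∃ t s', P.Runs s t s' ∧ t ≤ T ∧ I j s') (j : ℕ) (s : RAMState)
    (hs : I j s) : ∃ t s', (loop x P).Runs s t s' ∧ t ≤ j * (T + 1) + 1 ∧ I 0 s' := by
  induction j generalizing s with
  | zero => exact ⟨1, s, .loop_done (hx 0 s hs), by simp, hs⟩
  | succ j ih =>
    obtain ⟨t, s', h, ht, hs'⟩ := hP j s hs
    obtain ⟨t', s'', h', ht', hs''⟩ := ih s' hs'
    exact ⟨1 + t + t', s'', .loop_step (by rw [hx _ s hs]; simp) h h', by linarith, hs''⟩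

/-- Add `a` times the content of register `0` to register `x`. -/
theorem exists_runs_addLength (x a : ℕ) (hx : x ≠ 0) : ∃ (P : RAMProgram) (c : ℕ), ∀ s : RAMState,
    P.Runs s c (s.setReg x (s.reg x + a * s.reg 0)) := by
  induction a with
  | zero => exact ⟨.skip, 1, fun s => by simpa [RAMState.setReg] using Runs.skip s⟩
  | succ a ih =>
    obtain ⟨P, c, h⟩ := ih
    -- Multiplication by the constant `a` is unrolled into `a` additions, so the step count does not
    -- depend on the state.
    refine ⟨.seq P (.add x x 0), c + 1, fun s => .seq (h s) ?_⟩
    have := Runs.add (s.setReg x (s.reg x + a * s.reg 0)) x x 0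
    have h0 : 0 ≠ x := hx.symm
    convert this using 1
    simp [RAMState.setReg, h0]
    ring_nf

end RAMProgram

open RAMProgram in
-- Registers are used as a stack: the code generated at height `k` leaves everything below `k`
-- intact and puts the value into register `k`, while `η` says where the variables live. Memory is
-- only read, so `Represents` survives the evaluation of subexpressions. The bound `p` is chosen
-- before the input, which makes the compilation uniform.
theorem ArrayExpr.exists_program (e : ArrayExpr) : ∀ (η : ℕ → ℕ) (k : ℕ), 0 < k → (∀ x, η x < k) →
    ∃ (P : RAMProgram) (p : Polynomial ℕ), ∀ (w : List Bool) (σ : ℕ → ℕ → ℕ) (ρ : ℕ → ℕ)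
      (s : RAMState), Represents w σ s → (∀ x, s.reg (η x) = ρ x) →
      ∃ (t : ℕ) (s' : RAMState), P.Runs s t s' ∧ t ≤ p.eval w.length ∧ s'.mem = s.mem ∧
        (∀ r < k, s'.reg r = s.reg r) ∧ s'.reg k = e.eval w σ ρ := by
  induction e with
  | const c =>
    intro η k hk hη
    refine ⟨.const k c, 1, fun w σ ρ s hs hρ => ⟨_, _, .const _ _ _, by simp, rfl, ?_, ?_⟩⟩
    · intro r hr; simp [RAMState.setReg, hr.ne]
    · simp [RAMState.setReg, eval]
  | var x =>
    intro η k hk hη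
    refine ⟨.seq (.const k 0) (.add k (η x) k), 2, fun w σ ρ s hs hρ =>
      ⟨_, _, .seq (.const _ _ _) (.add _ _ _ _), by simp, rfl, ?_, ?_⟩⟩
    · intro r hr; simp [RAMState.setReg, hr.ne]
    · simp [RAMState.setReg, eval, (hη x).ne, hρ]
  | input e ih =>
    intro η k hk hη
    obtain ⟨P, p, h⟩ := ih η k hk hη
    -- The index is tested against the length because the cells beyond the input hold arrays,
    -- whereas the input reads as `0` there.
    refine ⟨.seq P (.seq (.sub (k + 1) 0 k) (.cond (k + 1) (.load k k) (.const k 0))), p + 3,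
      fun w σ ρ s hs hρ => ?_⟩
    obtain ⟨t, s', hr, ht, hm, hp, hv⟩ := h w σ ρ s hs hρ
    have hlen : s'.reg 0 = w.length := by rw [hp 0 hk, hs.len]
    by_cases hlt : e.eval w σ ρ < w.length
    · refine ⟨_, _, .seq hr (.seq (.sub _ _ _ _) (.cond_true ?_ (.load _ _ _))), ?_, ?_, ?_, ?_⟩
      · simp [RAMState.setReg, hlen, hv]; omega
      · simp; omega
      · simp [RAMState.setReg, hm]
      · intro r hr
        have : r ≠ k + 1 := by omega
        simp [RAMState.setReg, hr.ne, this, hp r hr]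
      · simp [RAMState.setReg, eval, hv, hm, hs.input _ hlt]
    · refine ⟨_, _, .seq hr (.seq (.sub _ _ _ _) (.cond_false ?_ (.const _ _ _))), ?_, ?_, ?_, ?_⟩
      · simp [RAMState.setReg, hlen, hv]; omega
      · simp; omega
      · simp [RAMState.setReg, hm]
      · intro r hr
        have : r ≠ k + 1 := by omega
        simp [RAMState.setReg, hr.ne, this, hp r hr]
      · simp only [not_lt] at hlt
        simp [RAMState.setReg, eval, RAMState.ofInput, List.getElem?_eq_none hlt]
  | read a e ih =>
    intro η k hk hη
    obtain ⟨P, p, h⟩ := ih η k hk hη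
    obtain ⟨Q, c, hQ⟩ := exists_runs_addLength k (a + 2) hk.ne'
    refine ⟨.seq P (.seq (.sub (k + 1) 0 k) (.cond (k + 1) (.seq Q (.load k k)) (.const k 0))),
      p + 3 + Polynomial.C c, fun w σ ρ s hs hρ => ?_⟩
    obtain ⟨t, s', hr, ht, hm, hp, hv⟩ := h w σ ρ s hs hρ
    have hlen : s'.reg 0 = w.length := by rw [hp 0 hk, hs.len]
    by_cases hlt : e.eval w σ ρ < w.length
    · refine ⟨_, _, .seq hr (.seq (.sub _ _ _ _) (.cond_true ?_ (.seq (hQ _) (.load _ _ _)))),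
        ?_, ?_, ?_, ?_⟩
      · simp [RAMState.setReg, hlen, hv]; omega
      · simp; omega
      · simp [RAMState.setReg, hm]
      · intro r hr
        have : r ≠ k + 1 := by omega
        simp [RAMState.setReg, hr.ne, this, hp r hr]
      · simp [RAMState.setReg, eval, hv, hm, hlt, hlen, hs.array _ _ hlt]
    · refine ⟨_, _, .seq hr (.seq (.sub _ _ _ _) (.cond_false ?_ (.const _ _ _))), ?_, ?_, ?_, ?_⟩
      · simp [RAMState.setReg, hlen, hv]; omega
      · simp; omega
      · simp [RAMState.setReg, hm]
      · intro r hr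
        have : r ≠ k + 1 := by omega
        simp [RAMState.setReg, hr.ne, this, hp r hr]
      · simp [RAMState.setReg, eval, hlt]
  | add e f ihe ihf =>
    intro η k hk hη
    obtain ⟨P, p, hP⟩ := ihe η k hk hη
    -- Compiled one level higher, so that the first summand in register `k` survives.
    obtain ⟨Q, q, hQ⟩ := ihf η (k + 1) (by omega) (fun x => (hη x).trans (by omega))
    refine ⟨.seq P (.seq Q (.add k k (k + 1))), p + q + 1, fun w σ ρ s hs hρ => ?_⟩
    obtain ⟨t, s', hr, ht, hm, hp, hv⟩ := hP w σ ρ s hs hρ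
    obtain ⟨t', s'', hr', ht', hm', hp', hv'⟩ := hQ w σ ρ s' (hs.congr hk hm hp)
      fun x => by rw [hp _ (hη x), hρ]
    refine ⟨_, _, .seq hr (.seq hr' (.add _ _ _ _)), ?_, ?_, ?_, ?_⟩
    · simp; omega
    · simp [RAMState.setReg, hm, hm']
    · intro r hr
      simp [RAMState.setReg, hr.ne, hp r hr, hp' r (hr.trans (by omega))]
    · simp [RAMState.setReg, eval, hv', hp' k (by omega), hv]
  | sub e f ihe ihf =>
    intro η k hk hη
    obtain ⟨P, p, hP⟩ := ihe η k hk hη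
    obtain ⟨Q, q, hQ⟩ := ihf η (k + 1) (by omega) (fun x => (hη x).trans (by omega))
    refine ⟨.seq P (.seq Q (.sub k k (k + 1))), p + q + 1, fun w σ ρ s hs hρ => ?_⟩
    obtain ⟨t, s', hr, ht, hm, hp, hv⟩ := hP w σ ρ s hs hρ
    obtain ⟨t', s'', hr', ht', hm', hp', hv'⟩ := hQ w σ ρ s' (hs.congr hk hm hp)
      fun x => by rw [hp _ (hη x), hρ]
    refine ⟨_, _, .seq hr (.seq hr' (.sub _ _ _ _)), ?_, ?_, ?_, ?_⟩
    · simp; omega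
    · simp [RAMState.setReg, hm, hm']
    · intro r hr
      simp [RAMState.setReg, hr.ne, hp r hr, hp' r (hr.trans (by omega))]
    · simp [RAMState.setReg, eval, hv', hp' k (by omega), hv]
  | cond c e f ihc ihe ihf =>
    intro η k hk hη
    obtain ⟨R, r, hR⟩ := ihc η k hk hη
    obtain ⟨P, p, hP⟩ := ihe η k hk hη
    obtain ⟨Q, q, hQ⟩ := ihf η k hk hη
    refine ⟨.seq R (.cond k P Q), r + p + q + 1, fun w σ ρ s hs hρ => ?_⟩
    obtain ⟨t, s', hr, ht, hm, hp, hv⟩ := hR w σ ρ s hs hρ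
    have hs' := hs.congr hk hm hp
    have hρ' : ∀ x, s'.reg (η x) = ρ x := fun x => by rw [hp _ (hη x), hρ]
    by_cases hc : c.eval w σ ρ ≠ 0
    · obtain ⟨t', s'', hr', ht', hm', hp', hv'⟩ := hP w σ ρ s' hs' hρ'
      refine ⟨_, _, .seq hr (.cond_true (hv ▸ hc) hr'), ?_, hm'.trans hm, ?_, ?_⟩
      · simp; omega
      · intro r hr; rw [hp' r hr, hp r hr]
      · simp [eval, hv', hc]
    · obtain ⟨t', s'', hr', ht', hm', hp', hv'⟩ := hQ w σ ρ s' hs' hρ'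
      refine ⟨_, _, .seq hr (.cond_false (hv ▸ not_not.1 hc) hr'), ?_, hm'.trans hm, ?_, ?_⟩
      · simp; omega
      · intro r hr; rw [hp' r hr, hp r hr]
      · simp [eval, hv', not_not.1 hc]
  | sum x e ih =>
    intro η k hk hη
    -- Register `k` accumulates, `k + 1` is both the loop counter and the bound variable, and `k +
    -- 2` holds the constant `1` and then the summand.
    obtain ⟨P, p, hP⟩ := ih (Function.update η x (k + 1)) (k + 2) (by omega) (fun y => by
      rcases eq_or_ne y x with rfl | h
      · simp
      · simpa [h] using (hη y).trans (by omega))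
    refine ⟨.seq (.const k 0) (.seq (.const (k + 1) 0) (.seq (.add (k + 1) (k + 1) 0)
      (.loop (k + 1) (.seq (.const (k + 2) 1) (.seq (.sub (k + 1) (k + 1) (k + 2))
        (.seq P (.add k k (k + 2)))))))), Polynomial.X * (p + 3 + 1) + 1 + 3,
        fun w σ ρ s hs hρ => ?_⟩
    let s₀ : RAMState := ((s.setReg k 0).setReg (k + 1) 0).setReg (k + 1) w.length
    have hs₀ : ((s.setReg k 0).setReg (k + 1) 0).setReg (k + 1)
        (((s.setReg k 0).setReg (k + 1) 0).reg (k + 1) +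
          ((s.setReg k 0).setReg (k + 1) 0).reg 0) = s₀ := by
      simp [RAMState.setReg, s₀, hk.ne, hs.len]
    obtain ⟨t, s', hr, ht, -, hm, hp, hv⟩ := exists_runs_loop (x := k + 1)
      (P := .seq (.const (k + 2) 1) (.seq (.sub (k + 1) (k + 1) (k + 2))
        (.seq P (.add k k (k + 2))))) (T := p.eval w.length + 3)
      -- The counter descends, so the terms with index below `j` are still to be added.
      (fun j s' => s'.reg (k + 1) = j ∧ s'.mem = s.mem ∧ (∀ r < k, s'.reg r = s.reg r) ∧
        s'.reg k + ∑ i ∈ Finset.range j, e.eval w σ (Function.update ρ x i) =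
          (sum x e).eval w σ ρ) (fun j s h => h.1)
      (by
        rintro j s' ⟨hj, hm, hp, hv⟩
        let s₁ : RAMState := (s'.setReg (k + 2) 1).setReg (k + 1) j
        obtain ⟨t, s₂, hr₂, ht₂, hm₂, hp₂, hv₂⟩ := hP w σ (Function.update ρ x j) s₁
          (hs.congr hk hm fun r hr => by
            simp [s₁, RAMState.setReg, show r ≠ k + 1 by omega, show r ≠ k + 2 by omega, hp r hr])
          (fun y => by
            rcases eq_or_ne y x with rfl | h
            · simp [s₁, RAMState.setReg]
            · have := hη y
              simp [h, s₁, RAMState.setReg, show η y ≠ k + 1 by omega, show η y ≠ k + 2 by omega,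
                hp _ this, hρ])
        refine ⟨1 + (1 + (t + 1)), _, .seq (.const _ _ _) (.seq (s' := s₁) ?_
          (.seq hr₂ (.add _ _ _ _))), by omega, ?_, ?_, ?_, ?_⟩
        · have := Runs.sub (s'.setReg (k + 2) 1) (k + 1) (k + 1) (k + 2)
          simpa [RAMState.setReg, hj, s₁] using this
        · simp [RAMState.setReg, hp₂, s₁]
        · simp [RAMState.setReg, hm₂, s₁, hm]
        · intro r hr
          simp [RAMState.setReg, hr.ne, hp₂ r (by omega), s₁, show r ≠ k + 1 by omega,
            show r ≠ k + 2 by omega, hp r hr]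
        · rw [← hv, Finset.sum_range_succ]
          simp [RAMState.setReg, hv₂, hp₂, s₁]
          ring)
      w.length s₀ ⟨by simp [s₀, RAMState.setReg], rfl, fun r hr => by
        simp [s₀, RAMState.setReg, hr.ne, show r ≠ k + 1 by omega], by
        simp [s₀, RAMState.setReg, eval]⟩
    refine ⟨_, s', .seq (.const _ _ _) (.seq (.const _ _ _) (.seq (.add _ _ _ _)
      (hs₀ ▸ hr))), ?_, hm, hp, by simpa using hv⟩
    simp; omega

/-- Uniqueness of division with remainder: distinct memory blocks, and distinct offsets in a block,
never share a cell. -/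
theorem eq_of_add_mul_eq_add_mul {L i j a b : ℕ} (hi : i < L) (hj : j < L)
    (h : i + a * L = j + b * L) : i = j ∧ a = b := by
  have hmod := congrArg (· % L) h
  have hdiv := congrArg (· / L) h
  have hL : 0 < L := by omega
  simp only [Nat.add_mul_mod_self_right, Nat.mod_eq_of_lt hi, Nat.mod_eq_of_lt hj] at hmod
  simp only [Nat.add_mul_div_right _ _ hL, Nat.div_eq_of_lt hi, Nat.div_eq_of_lt hj,
    zero_add] at hdiv
  exact ⟨hmod, hdiv⟩

open RAMProgram in
-- An assignment changes all entries simultaneously, but the expression may read the array being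
-- assigned. The new entries are therefore collected in block `1`, which holds neither input nor
-- array, and copied to their destination only when all of them are known.
theorem ArrayProgram.exists_program (c : ArrayProgram) : ∀ k, 0 < k →
    ∃ (P : RAMProgram) (p : Polynomial ℕ), ∀ (w : List Bool) (σ : ℕ → ℕ → ℕ) (s : RAMState),
      Represents w σ s → ∃ (t : ℕ) (s' : RAMState), P.Runs s t s' ∧ t ≤ p.eval w.length ∧
        Represents w (c.eval w σ) s' ∧ ∀ r < k, s'.reg r = s.reg r := by
  induction c with
  | assign a e =>
    intro k hk
    -- All variables live in the loop counter, since each of them denotes the index of the entry.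
    obtain ⟨P, p, hP⟩ := e.exists_program (fun _ => k) (k + 1) (by omega) (by simp)
    obtain ⟨Q, c, hQ⟩ := exists_runs_addLength (k + 2) (a + 2) (by omega)
    refine ⟨.seq (.const k 0) (.seq (.add k k 0) (.seq (.loop k (.seq (.const (k + 1) 1)
      (.seq (.sub k k (k + 1)) (.seq P (.seq (.add (k + 2) k 0) (.store (k + 2) (k + 1)))))))
      (.seq (.add k k 0) (.loop k (.seq (.const (k + 1) 1) (.seq (.sub k k (k + 1))
        (.seq (.add (k + 1) k 0) (.seq (.load (k + 1) (k + 1)) (.seq (.const (k + 2) 0)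
          (.seq (.add (k + 2) (k + 2) k) (.seq Q (.store (k + 2) (k + 1))))))))))))),
      Polynomial.X * (p + 4 + 1) + 1 + (Polynomial.X * (Polynomial.C c + 7 + 1) + 1) + 3,
      fun w σ s hs => ?_⟩
    obtain ⟨L, hL⟩ : ∃ L, L = w.length := ⟨_, rfl⟩
    rw [← hL]
    obtain ⟨t₁, s₁, hr₁, ht₁, hj₁, -, hs₁, hp₁, hv₁⟩ := exists_runs_loop (x := k)
      (P := .seq (.const (k + 1) 1)
      (.seq (.sub k k (k + 1)) (.seq P (.seq (.add (k + 2) k 0) (.store (k + 2) (k + 1))))))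
      (T := p.eval L + 4)
      (fun j s' => s'.reg k = j ∧ j ≤ L ∧ Represents w σ s' ∧ (∀ r < k, s'.reg r = s.reg r) ∧
        ∀ i, j ≤ i → i < L → s'.mem (i + L) = e.eval w σ fun _ => i)
      (fun j s h => h.1)
      (by
        rintro j s' ⟨hj, hjL, hs', hp, hv⟩
        let s₁ : RAMState := (s'.setReg (k + 1) 1).setReg k j
        obtain ⟨t, s₂, hr₂, ht₂, hm₂, hp₂, hv₂⟩ := hP w σ (fun _ => j) s₁
          (hs'.congr hk rfl fun r hr => by
            simp [s₁, RAMState.setReg, hr.ne, show r ≠ k + 1 by omega])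
          (fun y => by simp [s₁, RAMState.setReg])
        rw [← hL] at ht₂
        have hlen : s₂.reg 0 = L := by
          rw [hp₂ 0 (by omega)]; simp [s₁, RAMState.setReg, hk.ne, hs'.len, hL]
        have hjk : s₂.reg k = j := by rw [hp₂ k (by omega)]; simp [s₁, RAMState.setReg]
        have hmem : s₂.mem = s'.mem := by rw [hm₂]; simp [s₁, RAMState.setReg]
        refine ⟨1 + (1 + (t + (1 + 1))), _, .seq (.const _ _ _) (.seq (s' := s₁) ?_
          (.seq hr₂ (.seq (.add _ _ _ _) (.store _ _ _)))), by omega, ?_, by omega, ⟨?_, ?_, ?_⟩, ?_, ?_⟩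
        · have := Runs.sub (s'.setReg (k + 1) 1) k k (k + 1)
          simpa [RAMState.setReg, hj, s₁] using this
        · simp [RAMState.setReg, RAMState.setMem, hjk]
        · simp [RAMState.setReg, RAMState.setMem, hlen, hL]
        · intro i hi
          simp [RAMState.setReg, RAMState.setMem, hlen, hjk, hmem,
            show i ≠ j + L by omega, hs'.input i hi]
        · intro b i hi
          have : i + (b + 2) * w.length ≠ j + L := by
            intro h
            have := (eq_of_add_mul_eq_add_mul (b := 1) hi (hL ▸ hjL) (by rw [h, hL, one_mul])).2
            omega
          simp [RAMState.setReg, RAMState.setMem, hlen, hjk, hmem, this, hs'.array b i hi]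
        · intro r hr
          simp [RAMState.setReg, RAMState.setMem, hp₂ r (by omega), s₁, show r ≠ k + 1 by omega,
            show r ≠ k + 2 by omega, hr.ne, hp r hr]
        · intro i hji hi
          rcases hji.eq_or_lt with rfl | h
          · simp [RAMState.setReg, RAMState.setMem, hlen, hjk, hv₂]
          · simp [RAMState.setReg, RAMState.setMem, hlen, hjk, h.ne', hmem, hv i h hi])
      L ((s.setReg k 0).setReg k L) ⟨by simp [RAMState.setReg], le_rfl,
        hs.congr hk rfl fun r hr => by simp [RAMState.setReg, hr.ne], fun r hr => by
        simp [RAMState.setReg, hr.ne], fun i h h' => by omega⟩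
    obtain ⟨t₂, s₂, hr₂, ht₂, -, -, hs₂, -, hp₂, hv₂⟩ := exists_runs_loop (x := k)
      (P := .seq (.const (k + 1) 1) (.seq (.sub k k (k + 1))
        (.seq (.add (k + 1) k 0) (.seq (.load (k + 1) (k + 1)) (.seq (.const (k + 2) 0)
          (.seq (.add (k + 2) (k + 2) k) (.seq Q (.store (k + 2) (k + 1)))))))))
      (T := c + 7)
      -- During the copying, array `a` has its new entries from `j` on only; the other arrays, the
      -- input and block `1` are untouched.
      (fun j s' => s'.reg k = j ∧ j ≤ L ∧ (∀ i < L, s'.mem i = (RAMState.ofInput w).mem i) ∧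
        (∀ i < L, s'.mem (i + L) = e.eval w σ fun _ => i) ∧ (∀ r < k, s'.reg r = s.reg r) ∧
        ∀ b, ∀ i < L, (b = a → j ≤ i) →
          s'.mem (i + (b + 2) * L) = Function.update σ a (fun i => e.eval w σ fun _ => i) b i)
      (fun j s h => h.1)
      (by
        rintro j s' ⟨hj, hjL, hin, htmp, hp, hv⟩
        have hlen : s'.reg 0 = L := by rw [hp 0 hk, hs.len, hL]
        refine ⟨1 + (1 + (1 + (1 + (1 + (1 + (c + 1)))))), _, .seq (.const _ _ _)
          (.seq (.sub _ _ _ _) (.seq (.add _ _ _ _) (.seq (.load _ _ _) (.seq (.const _ _ _)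
          (.seq (.add _ _ _ _) (.seq (hQ _) (.store _ _ _))))))), by omega, ?_, by omega, ?_, ?_,
          ?_, ?_⟩
        · simp [RAMState.setReg, RAMState.setMem, hj]
        · intro i hi
          have : i ≠ j + (a + 2) * L := by
            intro h
            have := (eq_of_add_mul_eq_add_mul (a := 0) hi hjL (by rw [← h, zero_mul]; rfl)).2
            omega
          simp [RAMState.setReg, RAMState.setMem, hj, hk.ne, hlen, this, hin i hi]
        · intro i hi
          have : i + L ≠ j + (a + 2) * L := by
            intro h
            have := (eq_of_add_mul_eq_add_mul (a := 1) hi hjL (by rw [← h, one_mul])).2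
            omega
          simp [RAMState.setReg, RAMState.setMem, hj, hk.ne, hlen, this, htmp i hi]
        · intro r hr
          simp [RAMState.setReg, RAMState.setMem, show r ≠ k + 1 by omega,
            show r ≠ k + 2 by omega, hr.ne, hp r hr]
        · intro b i hi hba
          by_cases h : i + (b + 2) * L = j + (a + 2) * L
          · obtain ⟨rfl, h⟩ := eq_of_add_mul_eq_add_mul hi hjL h
            obtain rfl : b = a := by omega
            simp [RAMState.setReg, RAMState.setMem, hj, hk.ne, hlen, htmp i hi]
          · have := hv b i hi fun hb => by
              have := hba hb
              subst hb
              rcases this.eq_or_lt with rfl | h'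
              · exact absurd rfl h
              · exact h'
            simp [RAMState.setReg, RAMState.setMem, hj, hk.ne, hlen, h, this])
      L (s₁.setReg k L) ⟨by simp [RAMState.setReg], le_rfl, hL ▸ hs₁.input, fun i hi => hv₁ i i.zero_le hi,
        fun r hr => by simp [RAMState.setReg, hr.ne, hp₁ r hr], fun b i hi hb => by
        rcases eq_or_ne b a with rfl | h
        · have := hb rfl
          omega
        · simpa [RAMState.setReg, h, hL] using hs₁.array b i (hL ▸ hi)⟩
    refine ⟨1 + (1 + (t₁ + (1 + t₂))), s₂, .seq (.const _ _ _) (.seq (s' := (s.setReg k 0).setReg k L) ?_ (.seq hr₁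
      (.seq (s' := s₁.setReg k L) ?_ hr₂))), ?_,
      ⟨by rw [hp₂ 0 hk, hs.len], hL ▸ hs₂,
        fun b i hi => hL ▸ hv₂ b i (hL ▸ hi) fun _ => i.zero_le⟩, hp₂⟩
    · have := Runs.add (s.setReg k 0) k k 0
      simpa [RAMState.setReg, hk.ne, hs.len, hL] using this
    · have := Runs.add s₁ k k 0
      simpa [RAMState.setReg, hj₁, hs₁.len, hL] using this
    · simp; omega
  | seq P Q ihP ihQ =>
    intro k hk
    obtain ⟨P', p, hP⟩ := ihP k hk
    obtain ⟨Q', q, hQ⟩ := ihQ k hk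
    refine ⟨.seq P' Q', p + q, fun w σ s hs => ?_⟩
    obtain ⟨t, s', hr, ht, hs', hp⟩ := hP w σ s hs
    obtain ⟨t', s'', hr', ht', hs'', hp'⟩ := hQ w _ s' hs'
    exact ⟨t + t', s'', .seq hr hr', by simp; omega, hs'', fun r h => by rw [hp' r h, hp r h]⟩
  | rep P ih =>
    intro k hk
    -- The body has to preserve the counter in register `k`.
    obtain ⟨Q, q, hQ⟩ := ih (k + 1) (by omega)
    refine ⟨.seq (.const k 0) (.seq (.add k k 0) (.loop k (.seq (.const (k + 1) 1)
      (.seq (.sub k k (k + 1)) Q)))), Polynomial.X * (q + 2 + 1) + 1 + 2, fun w σ s hs => ?_⟩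
    obtain ⟨t, s', hr, ht, -, hp, j, hj, hv⟩ := exists_runs_loop (x := k)
      (P := .seq (.const (k + 1) 1) (.seq (.sub k k (k + 1)) Q)) (T := q.eval w.length + 2)
      (fun j s' => s'.reg k = j ∧ (∀ r < k, s'.reg r = s.reg r) ∧
        ∃ i, i + j = w.length ∧ Represents w ((P.eval w)^[i] σ) s') (fun j s h => h.1)
      (by
        rintro j s' ⟨hj, hp, i, hi, hs'⟩
        obtain ⟨t, s₂, hr₂, ht₂, hs₂, hp₂⟩ := hQ w _ ((s'.setReg (k + 1) 1).setReg k j)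
          (hs'.congr hk rfl fun r hr => by
            simp [RAMState.setReg, hr.ne, show r ≠ k + 1 by omega])
        refine ⟨1 + (1 + t), s₂, .seq (.const _ _ _) (.seq ?_ hr₂), by omega, ?_, ?_, i + 1,
          by omega, ?_⟩
        · have := Runs.sub (s'.setReg (k + 1) 1) k k (k + 1)
          simpa [RAMState.setReg, hj] using this
        · rw [hp₂ k (by omega)]; simp [RAMState.setReg]
        · intro r hr
          rw [hp₂ r (by omega)]
          simp [RAMState.setReg, show r ≠ k + 1 by omega, hr.ne, hp r hr]
        · rwa [Function.iterate_succ_apply'])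
      w.length ((s.setReg k 0).setReg k w.length) ⟨by simp [RAMState.setReg], fun r hr => by
        simp [RAMState.setReg, hr.ne], 0, by simp,
        hs.congr hk rfl fun r hr => by simp [RAMState.setReg, hr.ne]⟩
    obtain rfl : j = w.length := by omega
    refine ⟨1 + (1 + t), s', .seq (.const _ _ _) (.seq (s' := (s.setReg k 0).setReg k w.length) ?_ hr),
      ?_, hv, hp⟩
    · have := Runs.add (s.setReg k 0) k k 0
      simpa [RAMState.setReg, hk.ne, hs.len] using this
    · simp; omega

theorem represents_ofInput (w : List Bool) : Represents w (fun _ _ => 0) (RAMState.ofInput w) where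
  len := by simp [RAMState.ofInput]
  input _ _ := rfl
  array a i hi := by
    have : w.length ≤ i + (a + 2) * w.length := by nlinarith
    simp [RAMState.ofInput, List.getElem?_eq_none this]

open RAMProgram in
/-- A search problem is solvable in polynomial time if an array program writes a solution to array
`0` and its length to array `1`. -/
theorem polyTimeSolvable_of_arrayProgram {α : Type} {β : α → Type} {encIn : α → List Bool}
    {encOut : (a : α) → β a → List Bool} {Sol : (a : α) → β a → Prop} (c : ArrayProgram)
    (h : ∀ a, 0 < (encIn a).length ∧ ∃ b, Sol a b ∧ (encOut a b).length ≤ (encIn a).length ∧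
      c.eval (encIn a) (fun _ _ => 0) 1 0 = (encOut a b).length ∧
      ∀ i (hi : i < (encOut a b).length),
        c.eval (encIn a) (fun _ _ => 0) 0 i ≠ 0 ↔ (encOut a b)[i] = true) :
    PolyTimeSolvable encIn encOut Sol := by
  obtain ⟨P, p, hP⟩ := c.exists_program 1 one_pos
  obtain ⟨Q, q, hQ⟩ := exists_runs_addLength 2 2 (by simp)
  obtain ⟨R, r, hR⟩ := exists_runs_addLength 2 3 (by simp)
  -- Array `0` in block `2` is copied over the input, and then entry `0` of array `1`, in cell `3 *
  -- L`, is loaded as the output length. Register `0` is overwritten last, because the address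
  -- computations need it. The final `Polynomial.X` pays for reading off the output.
  refine ⟨.seq P (.seq (.const 1 0) (.seq (.add 1 1 0) (.seq (.loop 1 (.seq (.const 2 1)
    (.seq (.sub 1 1 2) (.seq (.const 2 0) (.seq (.add 2 2 1) (.seq Q (.seq (.load 2 2)
      (.store 1 2)))))))) (.seq (.const 2 0) (.seq R (.load 0 2)))))),
    p + (Polynomial.X * (Polynomial.C q + 6 + 1) + 1) + Polynomial.C r + 4 + Polynomial.X,
    fun a => ?_⟩
  obtain ⟨hpos, b, hsol, hle, hlen, hbit⟩ := h a
  generalize encIn a = w at *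
  obtain ⟨t, s, hr, ht, hs, -⟩ := hP w _ _ (represents_ofInput w)
  generalize c.eval w (fun _ _ => 0) = σ at *
  obtain ⟨t', s', hr', ht', hj', -, hp', hs', hv'⟩ := exists_runs_loop (x := 1)
    (P := .seq (.const 2 1) (.seq (.sub 1 1 2) (.seq (.const 2 0) (.seq (.add 2 2 1) (.seq Q
      (.seq (.load 2 2) (.store 1 2))))))) (T := q + 6)
    (fun j s' => s'.reg 1 = j ∧ j ≤ w.length ∧ s'.reg 0 = w.length ∧
      (∀ a, ∀ i < w.length, s'.mem (i + (a + 2) * w.length) = σ a i) ∧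
      ∀ i, j ≤ i → i < w.length → s'.mem i = σ 0 i) (fun j s h => h.1)
    (by
      rintro j s' ⟨hj, hjL, hl, hs', hv⟩
      refine ⟨1 + (1 + (1 + (1 + (q + (1 + 1))))), _, .seq (.const _ _ _) (.seq (.sub _ _ _ _)
        (.seq (.const _ _ _) (.seq (.add _ _ _ _) (.seq (hQ _) (.seq (.load _ _ _)
          (.store _ _ _)))))), by omega, ?_, by omega, ?_, ?_, ?_⟩
      · simp [RAMState.setReg, RAMState.setMem, hj]
      · simp [RAMState.setReg, RAMState.setMem, hl]
      · intro b i hi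
        have : i + (b + 2) * w.length ≠ j := by nlinarith
        simp [RAMState.setReg, RAMState.setMem, hj, this, hs' b i hi]
      · intro i hji hi
        rcases hji.eq_or_lt with rfl | h
        · simpa [RAMState.setReg, RAMState.setMem, hj, hl] using hs' 0 j hi
        · simp [RAMState.setReg, RAMState.setMem, hj, h.ne', hv i h hi])
    w.length (s.setReg 1 w.length) ⟨by simp [RAMState.setReg], le_rfl,
      by simp [RAMState.setReg, hs.len], hs.array,
      fun i h h' => by omega⟩
  have hadd : (RAMProgram.add 1 1 0).Runs (s.setReg 1 0) 1 (s.setReg 1 w.length) := by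
    have := Runs.add (s.setReg 1 0) 1 1 0
    simpa [RAMState.setReg, hs.len] using this
  refine ⟨b, t + (1 + (1 + (t' + (1 + (r + 1))))), _, .seq hr (.seq (.const _ _ _) (.seq hadd
    (.seq hr' (.seq (.const _ _ _) (.seq (hR _) (.load _ _ _)))))), ?_, ?_, hsol⟩
  · have h1 := hs' 1 0 hpos
    simp only [hlen, zero_add] at h1
    apply List.ext_getElem
    · simp [RAMState.output, RAMState.setReg, hp', h1]
    · intro i h₁ h₂
      have := hbit i h₂
      rw [← hv' i i.zero_le (by omega)] at this
      simp only [RAMState.output, RAMState.setReg, List.getElem_map, List.getElem_range]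
      rw [Bool.eq_iff_iff, ← this]
      simp
  · simp; omega

/-! ## Optimal first-stage solutions -/

section Optimality

theorem IsStable.mono {V : Type*} {G : SimpleGraph V} {S T : Finset V} (h : IsStable G T)
    (hST : S ⊆ T) : IsStable G S :=
  Set.Pairwise.mono (Finset.coe_subset.2 hST) h

variable {V : Type*} [Fintype V] [DecidableEq V] {G : SimpleGraph V} {S T : Finset V}

theorem mem_recourses {F : Finset V → Prop} {f e : Option V} :
    e ∈ recourses F S f ↔ Disjoint e.toFinset (S ∪ f.toFinset) ∧ F (secondStage S f e) := by
  simp [recourses]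

theorem robustValue_le_card (hS : G.IsMaximumIndepSet S) :
    robustValue (IsStable G) T ≤ S.card :=
  (Finset.inf'_le _ (Finset.mem_univ none)).trans <| Finset.sup_le fun _ he =>
    hS.maximum _ (mem_recourses.1 he).2

theorem card_sub_one_le_robustValue (hS : IsStable G S) :
    S.card - 1 ≤ robustValue (IsStable G) S := by
  refine Finset.le_inf' _ _ fun f _ => ?_
  have h : none ∈ recourses (IsStable G) S f :=
    mem_recourses.2 ⟨by simp, by simpa [secondStage] using hS.mono Finset.sdiff_subset⟩
  refine le_trans ?_ (Finset.le_sup (f := fun e => (secondStage S f e).card) h)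
  have h1 := Finset.le_card_sdiff f.toFinset S
  have h2 : f.toFinset.card ≤ 1 := by cases f <;> simp
  simp only [secondStage, Option.toFinset_none, Finset.union_empty]
  omega

theorem IsRepairable.card_le_robustValue (hS : IsRepairable (IsStable G) S) :
    S.card ≤ robustValue (IsStable G) S := by
  refine Finset.le_inf' _ _ fun f _ => ?_
  suffices ∃ e ∈ recourses (IsStable G) S f, S.card ≤ (secondStage S f e).card by
    obtain ⟨e, he, h⟩ := this
    exact h.trans (Finset.le_sup (f := fun e => (secondStage S f e).card) he)
  have key : ∀ g : Option V, Disjoint S g.toFinset →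
      none ∈ recourses (IsStable G) S g ∧ S.card ≤ (secondStage S g none).card := fun g hg => by
    simp [mem_recourses, secondStage, Finset.sdiff_eq_self_of_disjoint hg, hS.1]
  rcases f with _ | f
  · exact ⟨none, key none (by simp)⟩
  by_cases hf : f ∈ S
  · obtain ⟨e, he, h⟩ := hS.2 f hf
    have hef : e ≠ f := fun h => he (h ▸ hf)
    have heq : secondStage S (some f) (some e) = insert e (S.erase f) := by
      ext v; simp [secondStage]; tauto
    refine ⟨some e, mem_recourses.2 ⟨by simp [he, hef], heq ▸ h⟩, ?_⟩
    rw [heq, Finset.card_insert_of_notMem (by simp [he]), Finset.card_erase_of_mem hf]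
    omega
  · exact ⟨none, key (some f) (by simpa using hf)⟩

/-- Suppose `T` had larger value. If `T` is maximum, the answer to each deletion from `T` must add a
vertex, so `T` is repairable. If `T` is smaller and nonempty, one deletion and one addition cannot
bring it up to the size of `S`. The empty `T` is the exception, treated below. -/
theorem robustValue_le_card_sub_one (hS : G.IsMaximumIndepSet S) (hT : IsStable G T)
    (hG : ¬ ∃ T : Finset V, IsRepairableMaximumStable G T) :
    robustValue (IsStable G) T ≤ S.card - 1 := by
  by_contra! hlt
  have key : ∀ f : Option V, ∃ e, Disjoint e.toFinset (T ∪ f.toFinset) ∧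
      IsStable G (secondStage T f e) ∧ S.card - 1 < (secondStage T f e).card := fun f => by
    have := hlt.trans_le (Finset.inf'_le _ (Finset.mem_univ f))
    obtain ⟨e, he, h⟩ := Finset.lt_sup_iff.1 this
    exact ⟨e, (mem_recourses.1 he).1, (mem_recourses.1 he).2, h⟩
  have hle := hS.maximum T hT
  rcases hle.eq_or_lt with hcard | hcard
  · refine hG ⟨T, ⟨hT, fun U hU => (hS.maximum U hU).trans hcard.ge⟩, hT, fun f hf => ?_⟩
    obtain ⟨e, hd, hst, hc⟩ := key (some f)
    rcases e with _ | e
    · simp [secondStage, Finset.sdiff_singleton_eq_erase, Finset.card_erase_of_mem hf, hcard] at hc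
    · refine ⟨e, by simp at hd; tauto, ?_⟩
      convert hst using 1
      ext v; simp [secondStage]; tauto
  · rcases T.eq_empty_or_nonempty with rfl | ⟨f, hf⟩
    -- Deleting nothing forces `S` to be a singleton `{v}`. Deleting `v`, which is not in `T`, then
    -- forbids `v` as an answer and produces another vertex, so `{v}` is repairable.
    · obtain ⟨e, -, -, hc⟩ := key none
      have hS1 : S.card = 1 := by
        have : e.toFinset.card ≤ 1 := by cases e <;> simp
        simp [secondStage] at hc hcard
        have := hcard.card_pos
        omega
      obtain ⟨v, rfl⟩ := Finset.card_eq_one.1 hS1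
      obtain ⟨e, hd, hst, hc⟩ := key (some v)
      rcases e with _ | e
      · simp [secondStage] at hc
      · refine hG ⟨{v}, hS, hS.isIndepSet, fun f hf => ⟨e, by simpa using hd, ?_⟩⟩
        obtain rfl := Finset.mem_singleton.1 hf
        simpa [secondStage] using hst
    · obtain ⟨e, hd, hst, hc⟩ := key (some f)
      have h1 : (secondStage T (some f) e).card ≤ _ := Finset.card_union_le _ _
      have h2 : e.toFinset.card ≤ 1 := by cases e <;> simp
      have h3 := Finset.card_pos.2 ⟨f, hf⟩
      simp only [Option.toFinset_some, Finset.sdiff_singleton_eq_erase,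
        Finset.card_erase_of_mem hf] at h1
      omega

theorem isRobustOptimal_of_isMaximumIndepSet (hS : G.IsMaximumIndepSet S)
    (h : IsRepairable (IsStable G) S ∨ ¬ ∃ T : Finset V, IsRepairableMaximumStable G T) :
    IsRobustOptimal (IsStable G) S := by
  refine ⟨hS.isIndepSet, fun T hT => ?_⟩
  rcases h with h | h
  · exact (robustValue_le_card hS).trans h.card_le_robustValue
  · exact (robustValue_le_card_sub_one hS hT h).trans (card_sub_one_le_robustValue hS.isIndepSet)

end Optimality

/-! ## Repairable maximum stable sets -/

section Repairable

variable {V : Type*} [Fintype V] {G : SimpleGraph V} {S T : Finset V}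

theorem isMaximumIndepSet_of_injOn (hS : IsStable G S)
    (h : ∀ T : Finset V, IsStable G T → ∃ g : V → V, (∀ t ∈ T, g t ∈ S) ∧ Set.InjOn g T) :
    G.IsMaximumIndepSet S :=
  ⟨hS, fun T hT => let ⟨g, hg, hinj⟩ := h T hT; Finset.card_le_card_of_injOn g hg hinj⟩

/-- A stable set `S` is maximum if the vertices outside are matched into it. -/
theorem isMaximumIndepSet_of_matching (hS : IsStable G S) (g : V → V)
    (hg : ∀ v, v ∉ S → g v ∈ S ∧ G.Adj v (g v))
    (hinj : ∀ v v', v ∉ S → v' ∉ S → g v = g v' → v = v') : G.IsMaximumIndepSet S := by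
  classical
  -- A stable `T` injects into `S` by fixing `T ∩ S` and following the matching elsewhere; a
  -- collision between the two kinds would be an edge inside `T`.
  refine isMaximumIndepSet_of_injOn hS fun T hT => ⟨fun t => if t ∈ S then t else g t, ?_, ?_⟩
  · intro t _
    by_cases h : t ∈ S
    · simp [h]
    · simpa [h] using (hg t h).1
  · intro t ht t' ht' heq
    by_cases h : t ∈ S <;> by_cases h' : t' ∈ S <;> simp only [h, h', if_true, if_false] at heq
    · exact heq
    · exact absurd (heq ▸ (hg t' h').2) (fun hadj => hT ht' ht hadj.ne hadj)
    · exact absurd (heq ▸ (hg t h).2) (fun hadj => hT ht ht' hadj.ne hadj)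
    · exact hinj t t' h h' heq

/-- The leaves, where only the smaller leaf is taken in a component that is an edge. -/
def IsChosenLeaf [LT V] (G : SimpleGraph V) (v : V) : Prop :=
  (∃! u, G.Adj v u) ∧ ∀ u, G.Adj v u → (¬ ∃! x, G.Adj u x) ∨ v < u

variable [DecidableEq V]

/-- Two adjacent chosen leaves would each be smaller than the other, so the set is stable. Sending
an outside vertex to its unique neighbour in `S` is injective because that neighbour is a leaf;
hence `S` is maximum. When the leaf `f` is deleted, its neighbour can replace it, having no other
neighbour in `S`. -/
theorem isRepairableMaximumStable_of_isChosenLeaf [LinearOrder V]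
    (hS : ∀ v, v ∈ S ↔ IsChosenLeaf G v)
    (hgood : ∀ v, v ∉ S → ∃! u, G.Adj v u ∧ u ∈ S) : IsRepairableMaximumStable G S := by
  have hst : IsStable G S := by
    intro u hu v hv _ hadj
    obtain ⟨hu1, hu2⟩ := (hS u).1 hu
    obtain ⟨hv1, hv2⟩ := (hS v).1 hv
    rcases hu2 v hadj with h | h
    · exact h hv1
    · rcases hv2 u hadj.symm with h' | h'
      · exact h' hu1
      · exact lt_asymm h h'
  choose! g hg hguniq using hgood
  refine ⟨isMaximumIndepSet_of_matching hst g (fun v hv => (hg v hv).symm) ?_, hst, ?_⟩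
  · intro v v' hv hv' heq
    have h := ((hS _).1 (hg v hv).2).1
    exact h.unique (hg v hv).1.symm (heq ▸ (hg v' hv').1.symm)
  · intro f hf
    obtain ⟨e, he, hfe⟩ := ((hS f).1 hf).1
    have heS : e ∉ S := fun h => hst hf h he.ne he
    refine ⟨e, heS, ?_⟩
    have key : ∀ v ∈ S.erase f, ¬ G.Adj e v := fun v hv hadj => by
      obtain ⟨hvf, hv⟩ := Finset.mem_erase.1 hv
      exact hvf ((hguniq e heS v ⟨hadj, hv⟩).trans (hguniq e heS f ⟨he.symm, hf⟩).symm)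
    intro u hu v hv huv hadj
    rcases Finset.mem_insert.1 (Finset.mem_coe.1 hu) with rfl | hu' <;>
      rcases Finset.mem_insert.1 (Finset.mem_coe.1 hv) with rfl | hv'
    · exact huv rfl
    · exact key v hv' hadj
    · exact key u hu' hadj.symm
    · exact hst (Finset.mem_of_mem_erase hu') (Finset.mem_of_mem_erase hv') huv hadj

/-- Both colour classes are stable and together cover all vertices. -/
theorem card_compl_le_of_isBipartite (hG : G.IsBipartite) (hT : G.IsMaximumIndepSet T) :
    Tᶜ.card ≤ T.card := by
  obtain ⟨c⟩ := hG
  have h (i : Fin 2) : (Finset.univ.filter fun v => c v = i).card ≤ T.card := by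
    refine hT.maximum _ fun u hu v hv _ hadj => c.valid hadj ?_
    simp only [Finset.coe_filter, Finset.mem_univ, true_and, Set.mem_ofPred_eq] at hu hv
    rw [hu, hv]
  have h2 : Fintype.card V = ∑ i : Fin 2, (Finset.univ.filter fun v => c v = i).card := by
    rw [← Finset.card_univ]
    exact Finset.card_eq_sum_card_fiberwise fun _ _ => Finset.mem_coe.2 (Finset.mem_univ _)
  rw [Fin.sum_univ_two] at h2
  have := h 0
  have := h 1
  rw [Finset.card_compl]
  omega

/-- In a bipartite graph, the edges that leave a repairable maximum stable set are a perfect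
matching. -/
theorem IsRepairableMaximumStable.exists_matching (hG : G.IsBipartite)
    (hT : IsRepairableMaximumStable G T) : ∃ e : V → V, (∀ f ∈ T, e f ∉ T) ∧
      (∀ f ∈ T, ∀ u, G.Adj f u ↔ u = e f) ∧
      (∀ f ∈ T, ∀ u ∈ T, G.Adj (e f) u → u = f) ∧ ∀ v, v ∉ T → ∃ f ∈ T, v = e f := by
  obtain ⟨hmax, hst, hrep⟩ := hT
  choose! e heT hest using hrep
  have hnbr : ∀ f ∈ T, ∀ u ∈ T, G.Adj (e f) u → u = f := fun f hf u hu hadj => by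
    by_contra h
    exact hest f hf (by simp) (by simp [hu, h]) hadj.ne hadj
  -- Otherwise `e f` has no neighbour in `T` at all and could be added to the maximum set `T`.
  have hadj : ∀ f ∈ T, G.Adj f (e f) := fun f hf => by
    by_contra h
    have : IsStable G (insert (e f) T) := by
      intro u hu v hv huv hadj
      have hno : ∀ w ∈ T, ¬ G.Adj (e f) w := fun w hw hadj => by
        have := hnbr f hf w hw hadj
        exact h (this ▸ hadj.symm)
      rcases Finset.mem_insert.1 hu with rfl | hu <;> rcases Finset.mem_insert.1 hv with rfl | hv
      · exact huv rfl
      · exact hno v hv hadj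
      · exact hno u hu hadj.symm
      · exact hst hu hv huv hadj
    have := hmax.maximum _ this
    rw [Finset.card_insert_of_notMem (heT f hf)] at this
    omega
  have hinj : Set.InjOn e T := fun f hf f' hf' h =>
    hnbr f' hf' f hf (h ▸ (hadj f hf).symm)
  -- This is where bipartiteness enters: the injective image of `T` lies in the complement, which is
  -- no larger.
  have himage : T.image e = Tᶜ := by
    refine Finset.eq_of_subset_of_card_le ?_ ?_
    · intro u hu
      obtain ⟨f, hf, rfl⟩ := Finset.mem_image.1 hu
      exact Finset.mem_compl.2 (heT f hf)
    · rw [Finset.card_image_of_injOn hinj]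
      exact card_compl_le_of_isBipartite hG hmax
  have hsurj : ∀ v, v ∉ T → ∃ f ∈ T, v = e f := fun v hv => by
    rw [← Finset.mem_compl, ← himage] at hv
    obtain ⟨f, hf, rfl⟩ := Finset.mem_image.1 hv
    exact ⟨f, hf, rfl⟩
  refine ⟨e, heT, fun f hf u => ⟨fun h => ?_, fun h => h ▸ hadj f hf⟩, hnbr, hsurj⟩
  have hu : u ∉ T := fun hu => hst hf hu h.ne h
  obtain ⟨f', hf', rfl⟩ := hsurj u hu
  rw [hnbr f' hf' f hf h.symm]

/-- Every `f` in `T` is a leaf, and it is chosen unless its edge to `e f` is a whole component with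
smaller end `e f`, in which case `e f` is chosen. So each pair `f`, `e f` serves its unchosen
member. A second chosen neighbour of `e f` cannot lie in `T`, nor outside, where it would be a leaf
attached to a vertex of `T`. -/
theorem IsRepairableMaximumStable.existsUnique_isChosenLeaf [LinearOrder V]
    (hG : G.IsBipartite)
    (hT : IsRepairableMaximumStable G T) (v : V) (hv : ¬ IsChosenLeaf G v) :
    ∃! u, G.Adj v u ∧ IsChosenLeaf G u := by
  obtain ⟨e, heT, hadj, hnbr, hsurj⟩ := hT.exists_matching hG
  have hleaf : ∀ f ∈ T, ∃! u, G.Adj f u := fun f hf =>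
    ⟨e f, (hadj f hf _).2 rfl, fun u hu => (hadj f hf u).1 hu⟩
  by_cases hvT : v ∈ T
  · have hev := (hadj v hvT (e v)).2 rfl
    have h : (∃! x, G.Adj (e v) x) ∧ ¬ v < e v := by
      by_contra h
      refine hv ⟨hleaf v hvT, fun u hu => ?_⟩
      obtain rfl := (hadj v hvT u).1 hu
      tauto
    refine ⟨e v, ⟨hev, h.1, fun u hu => .inr ?_⟩, fun u hu => (hadj v hvT u).1 hu.1⟩
    obtain rfl := h.1.unique hu hev.symm
    exact lt_of_le_of_ne (not_lt.1 h.2) hev.ne'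
  · obtain ⟨f, hf, rfl⟩ := hsurj v hvT
    have hfe := (hadj f hf (e f)).2 rfl
    refine ⟨f, ⟨hfe.symm, hleaf f hf, fun u hu => ?_⟩, fun u hu => ?_⟩
    · obtain rfl := (hadj f hf u).1 hu
      by_contra! h
      refine hv ⟨h.1, fun x hx => .inr ?_⟩
      obtain rfl := h.1.unique hx hfe.symm
      exact lt_of_le_of_ne h.2 hfe.ne'
    · by_cases huT : u ∈ T
      · exact hnbr f hf u huT hu.1
      · obtain ⟨f', hf', rfl⟩ := hsurj u huT
        have h1 := hu.2.1.unique hu.1.symm ((hadj f' hf' _).2 rfl).symm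
        exact absurd (h1 ▸ hf') hvT

end Repairable

/-! ### Maximum stable sets from the labels of a matching -/

/-- A stable set of a bipartite graph with sides `χ` and `¬ χ` is maximum if it is obtained from
labels `D` and a matching `m` by a gap `K` in the labels. -/
theorem isMaximumIndepSet_of_labels {V : Type*} [Fintype V] {G : SimpleGraph V} {S : Finset V}
    (χ : V → Prop) (D : V → ℕ) (m : V → V → Prop) (K : ℕ) (hK : 0 < K)
    (hχ : ∀ u v, G.Adj u v → (χ u ↔ ¬ χ v)) (hm : ∀ y x, m y x → χ x ∧ G.Adj x y)
    (hmx : ∀ y x x', m y x → m y x' → x = x') (hmy : ∀ y y' x, m y x → m y' x → y = y')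
    (hD : ∀ y, 0 < D y → ∃ x, m y x) (hmD : ∀ y x, m y x → ∀ y', G.Adj x y' → D y ≤ D y' + 1)
    (hfree : ∀ x, χ x → (∀ y, ¬ m y x) → ∀ y, G.Adj x y → K ≤ D y) (hgap : ∀ y, D y ≠ K)
    (hS : ∀ v, v ∈ S ↔ (χ v ∧ ∀ y, G.Adj v y → K ≤ D y) ∨ (¬ χ v ∧ D v < K)) :
    G.IsMaximumIndepSet S := by
  have hst : IsStable G S := by
    intro u hu v hv _ hadj
    have := hχ u v hadj
    rcases (hS u).1 hu with h | h <;> rcases (hS v).1 hv with h' | h'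
    · tauto
    · have := h.2 v hadj; omega
    · have := h'.2 u hadj.symm; omega
    · tauto
  -- A matched pair straddles `S`: the label of the matched `y` exceeds the least label around its
  -- partner by at most one, and as no label equals `K`, both lie on the same side of `K`.
  have hex : ∀ v, v ∉ S → ∃ u, u ∈ S ∧ (m u v ∨ m v u) := by
    intro v hv
    rw [hS] at hv
    by_cases hc : χ v
    · have : ∃ y, G.Adj v y ∧ D y < K := by
        by_contra! h
        exact hv (.inl ⟨hc, h⟩)
      obtain ⟨y', hy', hlt⟩ := this
      obtain ⟨y, hy⟩ : ∃ y, m y v := by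
        by_contra! h
        exact absurd (hfree v hc h y' hy') (by omega)
      refine ⟨y, (hS y).2 (.inr ⟨(hχ v y (hm y v hy).2).1 hc, ?_⟩), .inl hy⟩
      have := hmD y v hy y' hy'
      have := hgap y
      omega
    · have hle : K ≤ D v := by
        by_contra! h
        exact hv (.inr ⟨hc, h⟩)
      obtain ⟨x, hx⟩ := hD v (by omega)
      refine ⟨x, (hS x).2 (.inl ⟨(hm v x hx).1, fun y hy => ?_⟩), .inr hx⟩
      have := hmD v x hx y hy
      have := hgap v
      omega
  choose! g hgS hg using hex
  have hgadj : ∀ v, v ∉ S → G.Adj v (g v) := fun v hv => by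
    rcases hg v hv with h | h
    · exact (hm _ _ h).2
    · exact (hm _ _ h).2.symm
  refine isMaximumIndepSet_of_matching hst g (fun v hv => ⟨hgS v hv, hgadj v hv⟩) ?_
  intro v v' hv hv' heq
  have h1 := hχ _ _ (hgadj v hv)
  have h2 := hχ _ _ (hgadj v' hv')
  rcases hg v hv with h | h <;> rcases hg v' hv' with h' | h'
  · exact hmx _ _ _ h (heq ▸ h')
  · have := (hm _ _ h).1; have := (hm _ _ h').1; rw [heq] at *; tauto
  · have := (hm _ _ h).1; have := (hm _ _ h').1; rw [heq] at *; tauto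
  · exact hmy _ _ _ h (heq ▸ h')

/-! ## The input word of a graph -/

theorem List.getElem?_flatMap_of_length_eq {α β : Type*} {f : α → List β} {n : ℕ} {v : ℕ}
    (hv : v < n) (l : List α) (hf : ∀ a ∈ l, (f a).length = n) (u : ℕ) :
    (l.flatMap f)[u * n + v]? = l[u]?.bind fun a => (f a)[v]? := by
  induction l generalizing u with
  | nil => simp
  | cons a l ih =>
    have ha := hf a (by simp)
    rw [List.flatMap_cons]
    rcases u with _ | u
    · rw [List.getElem?_append_left (by omega)]
      simp
    · rw [List.getElem?_append_right (by rw [ha]; nlinarith), ha,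
        show (u + 1) * n + v - n = u * n + v by rw [add_mul, one_mul]; omega,
        ih (fun b hb => hf b (by simp [hb]))]
      simp

namespace BipartiteInstance

variable (I : BipartiteInstance)

theorem length_code : I.code.length = I.n + 1 + I.n * I.n := by
  simp [code, List.length_flatMap]
  ring

variable {I}

theorem lt_length_code (v : Fin I.n) : (v : ℕ) < I.code.length := by
  have := v.2
  rw [length_code]
  omega

theorem mem_ofInput_of_lt {i : ℕ} (hi : i < I.n) : (RAMState.ofInput I.code).mem i ≠ 0 := by
  have : I.code[i]? = some true := by
    rw [code, List.getElem?_append_left (by simpa using hi)]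
    simp [hi]
  simp [RAMState.ofInput, this]

theorem mem_ofInput_n : (RAMState.ofInput I.code).mem I.n = 0 := by
  have : I.code[I.n]? = some false := by
    rw [code, List.getElem?_append_right (by simp)]
    simp
  simp [RAMState.ofInput, this]

theorem mem_ofInput_adj (u v : Fin I.n) :
    (RAMState.ofInput I.code).mem (I.n + 1 + u * I.n + v) ≠ 0 ↔ I.graph.Adj u v := by
  classical
  have : I.code[I.n + 1 + u * I.n + v]? = some (decide (I.graph.Adj u v)) := by
    rw [code, List.getElem?_append_right (by simp; omega), List.length_replicate,
      show I.n + 1 + u * I.n + v - I.n = (u * I.n + v) + 1 by omega, List.getElem?_cons_succ,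
      List.getElem?_flatMap_of_length_eq v.2 _ (by simp)]
    simp
  simp [RAMState.ofInput, this]

end BipartiteInstance

/-! ## Derived expressions and programs -/

namespace ArrayExpr

/-- The condition `e` is true. -/
def Holds (w : List Bool) (σ : ℕ → ℕ → ℕ) (e : ArrayExpr) (ρ : ℕ → ℕ) : Prop := e.eval w σ ρ ≠ 0

def not (e : ArrayExpr) : ArrayExpr := .cond e (.const 0) (.const 1)
def and (e f : ArrayExpr) : ArrayExpr := .cond e f (.const 0)
def or (e f : ArrayExpr) : ArrayExpr := .add e f
def lt (e f : ArrayExpr) : ArrayExpr := .sub f e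
def le (e f : ArrayExpr) : ArrayExpr := not (lt f e)
def eq (e f : ArrayExpr) : ArrayExpr := and (le e f) (le f e)

section Holds

variable {w : List Bool} {σ : ℕ → ℕ → ℕ} {e f : ArrayExpr} {ρ : ℕ → ℕ}

@[simp] theorem holds_not : (not e).Holds w σ ρ ↔ ¬ e.Holds w σ ρ := by
  simp only [Holds, not, eval]; split_ifs <;> simp_all

@[simp] theorem holds_and : (and e f).Holds w σ ρ ↔ e.Holds w σ ρ ∧ f.Holds w σ ρ := by
  simp only [Holds, and, eval]; split_ifs <;> simp_all

@[simp] theorem holds_or : (or e f).Holds w σ ρ ↔ e.Holds w σ ρ ∨ f.Holds w σ ρ := by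
  simp only [Holds, or, eval]; omega

@[simp] theorem holds_lt : (lt e f).Holds w σ ρ ↔ e.eval w σ ρ < f.eval w σ ρ := by
  simp only [Holds, lt, eval]; omega

@[simp] theorem holds_le : (le e f).Holds w σ ρ ↔ e.eval w σ ρ ≤ f.eval w σ ρ := by
  simp [le]

@[simp] theorem holds_eq : (eq e f).Holds w σ ρ ↔ e.eval w σ ρ = f.eval w σ ρ := by
  simp [eq, le_antisymm_iff]

end Holds

/-- The number of vertices, stored in array `1`. -/
def size : ArrayExpr := .read 1 (.const 0)

/-- Whether `u` and `v` are adjacent; array `3` contains the positions of the rows of the adjacency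
matrix. -/
def adj (u v : ArrayExpr) : ArrayExpr :=
  and (lt u size) (and (lt v size) (.input (.add (.read 3 u) v)))

/-- Some vertex `x` satisfies `e`. -/
def ex (x : ℕ) (e : ArrayExpr) : ArrayExpr := .sum x (and (lt (.var x) size) e)

/-- All vertices `x` satisfy `e`. -/
def all (x : ℕ) (e : ArrayExpr) : ArrayExpr := not (ex x (not e))

/-- Exactly one vertex `x` satisfies `e`. -/
def unique (x : ℕ) (e : ArrayExpr) : ArrayExpr :=
  eq (.sum x (.cond (and (lt (.var x) size) e) (.const 1) (.const 0))) (.const 1)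

end ArrayExpr

/-- The arrays `1` and `3` contain the number of vertices and the positions of the rows of the
adjacency matrix. -/
structure Prepared (I : BipartiteInstance) (σ : ℕ → ℕ → ℕ) : Prop where
  size : σ 1 0 = I.n
  row : ∀ u : Fin I.n, σ 3 u = I.n + 1 + u * I.n

namespace Prepared

open ArrayExpr

variable {I : BipartiteInstance} {σ : ℕ → ℕ → ℕ} {ρ : ℕ → ℕ} {x : ℕ} {e : ArrayExpr}

theorem update (h : Prepared I σ) {a : ℕ} (h1 : 1 ≠ a) (h3 : 3 ≠ a) (f : ℕ → ℕ) :
    Prepared I (Function.update σ a f) :=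
  ⟨by simp [h1, h.size], by simp [h3, h.row]⟩

theorem eval_size (h : Prepared I σ) : ArrayExpr.size.eval I.code σ ρ = I.n := by
  have : 0 < I.code.length := by rw [I.length_code]; omega
  simp [ArrayExpr.size, eval, this, h.size]

theorem holds_adj (h : Prepared I σ) {e f : ArrayExpr} : (adj e f).Holds I.code σ ρ ↔
    ∃ u v : Fin I.n, e.eval I.code σ ρ = u ∧ f.eval I.code σ ρ = v ∧ I.graph.Adj u v := by
  simp only [adj, holds_and, holds_lt, h.eval_size]
  constructor
  · rintro ⟨hu, hv, hadj⟩
    refine ⟨⟨_, hu⟩, ⟨_, hv⟩, rfl, rfl, (BipartiteInstance.mem_ofInput_adj _ _).1 ?_⟩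
    rwa [← h.row, ← if_pos (c := eval I.code σ e ρ < I.code.length) (t := σ 3 _) (e := 0)]
    exact BipartiteInstance.lt_length_code ⟨_, hu⟩
  · rintro ⟨u, v, hu, hv, hadj⟩
    refine ⟨hu ▸ u.2, hv ▸ v.2, ?_⟩
    simp only [Holds, eval, hu, hv, BipartiteInstance.lt_length_code, if_true, h.row]
    exact (BipartiteInstance.mem_ofInput_adj u v).2 hadj

theorem holds_adj_of_eval_eq (h : Prepared I σ) {e f : ArrayExpr} {u v : Fin I.n}
    (hu : e.eval I.code σ ρ = u) (hv : f.eval I.code σ ρ = v) :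
    (adj e f).Holds I.code σ ρ ↔ I.graph.Adj u v := by
  rw [h.holds_adj]
  constructor
  · rintro ⟨u', v', hu', hv', hadj⟩
    rwa [Fin.ext (hu.symm.trans hu'), Fin.ext (hv.symm.trans hv')]
  · exact fun hadj => ⟨u, v, hu, hv, hadj⟩

theorem holds_ex (h : Prepared I σ) :
    (ex x e).Holds I.code σ ρ ↔ ∃ v : Fin I.n, e.Holds I.code σ (Function.update ρ x v) := by
  have : (ex x e).Holds I.code σ ρ ↔ ∃ j < I.code.length,
      (and (lt (var x) ArrayExpr.size) e).Holds I.code σ (Function.update ρ x j) := by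
    simp [Holds, ex, eval, Finset.sum_eq_zero_iff]
  rw [this]
  simp only [holds_and, holds_lt, h.eval_size, eval, Function.update_self]
  constructor
  · rintro ⟨j, -, hj, hv⟩
    exact ⟨⟨j, hj⟩, hv⟩
  · rintro ⟨v, hv⟩
    exact ⟨v, BipartiteInstance.lt_length_code v, v.2, hv⟩

theorem holds_all (h : Prepared I σ) :
    (all x e).Holds I.code σ ρ ↔ ∀ v : Fin I.n, e.Holds I.code σ (Function.update ρ x v) := by
  simp [all, h.holds_ex]

theorem holds_unique (h : Prepared I σ) : (ArrayExpr.unique x e).Holds I.code σ ρ ↔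
    ∃! v : Fin I.n, e.Holds I.code σ (Function.update ρ x v) := by
  classical
  -- Truth values may exceed `1`; the conditional normalises them so that the sum counts vertices.
  have key : ∀ j, eval I.code σ (.cond (and (lt (.var x) ArrayExpr.size) e) (.const 1) (.const 0))
      (Function.update ρ x j) =
      if j < I.n ∧ e.Holds I.code σ (Function.update ρ x j) then 1 else 0 := fun j => by
    have := holds_and (w := I.code) (σ := σ) (ρ := Function.update ρ x j)
      (e := lt (.var x) ArrayExpr.size) (f := e)
    rw [holds_lt, h.eval_size] at this
    simp only [eval, Function.update_self] at this ⊢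
    exact if_congr this rfl rfl
  rw [ArrayExpr.unique, holds_eq]
  simp only [eval] at key ⊢
  rw [Finset.sum_congr rfl fun j _ => key j, Finset.sum_boole, Nat.cast_id, Finset.card_eq_one]
  constructor
  · rintro ⟨j, hj⟩
    have hj' := Finset.ext_iff.1 hj
    simp only [Finset.mem_filter, Finset.mem_range, Finset.mem_singleton] at hj'
    obtain ⟨-, hjn, he⟩ := (hj' j).2 rfl
    exact ⟨⟨j, hjn⟩, he, fun v hv => Fin.ext
      ((hj' v).1 ⟨BipartiteInstance.lt_length_code v, v.2, hv⟩)⟩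
  · rintro ⟨v, hv, huniq⟩
    refine ⟨v, Finset.ext fun j => ?_⟩
    simp only [Finset.mem_filter, Finset.mem_range, Finset.mem_singleton]
    constructor
    · rintro ⟨-, hjn, he⟩
      exact congrArg Fin.val (huniq ⟨j, hjn⟩ he)
    · rintro rfl
      exact ⟨BipartiteInstance.lt_length_code v, v.2, hv⟩

end Prepared

namespace ArrayProgram

open ArrayExpr

/-- Fill array `t` with the least index that satisfies `e`, using array `2`. -/
def first (t : ℕ) (e : ArrayExpr) : ArrayProgram :=
  .seq (.assign 2 e) (.assign t (.sum 1 (.cond (.sum 2 (and (le (.var 2) (.var 1))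
    (.read 2 (.var 2)))) (.const 0) (.const 1))))

/-- The least index satisfying `e` equals the number of `j` such that no `l ≤ j` satisfies `e`;
without a solution this count is the input length. Tabulating `e` in array `2` first allows it to be
evaluated at a bound variable. -/
theorem eval_first (w : List Bool) (σ : ℕ → ℕ → ℕ) (t : ℕ) (e : ArrayExpr) :
    ∃ (f : ℕ → ℕ) (k : ℕ), (first t e).eval w σ =
      Function.update (Function.update σ 2 f) t (fun _ => k) ∧
      (k < w.length → e.Holds w σ (fun _ => k) ∧ ∀ j < k, ¬ e.Holds w σ (fun _ => j)) ∧
      (w.length ≤ k → ∀ j < w.length, ¬ e.Holds w σ (fun _ => j)) := by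
  classical
  obtain ⟨k, hk, hsmall, hbig⟩ : ∃ k ≤ w.length, (∀ j < k, ¬ e.Holds w σ (fun _ => j)) ∧
      (k < w.length → e.Holds w σ (fun _ => k)) := by
    by_cases h : ∃ j, j < w.length ∧ e.Holds w σ (fun _ => j)
    · exact ⟨Nat.find h, (Nat.find_spec h).1.le, fun j hj hj' =>
        Nat.find_min h hj ⟨hj.trans (Nat.find_spec h).1, hj'⟩, fun _ => (Nat.find_spec h).2⟩
    · push Not at h
      exact ⟨w.length, le_rfl, h, fun h => absurd h (lt_irrefl _)⟩
  refine ⟨fun i => e.eval w σ fun _ => i, k, ?_, fun h => ⟨hbig h, hsmall⟩,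
    fun h j hj => hsmall j (hj.trans_le h)⟩
  rw [first, eval, eval, eval]
  congr 1
  funext i
  set σ' := Function.update σ 2 fun i => e.eval w σ fun _ => i
  have key : ∀ j < w.length, ArrayExpr.eval w σ' (.cond (.sum 2 (and (le (.var 2) (.var 1))
    (.read 2 (.var 2)))) (.const 0) (.const 1)) (Function.update (fun _ => i) 1 j) =
      if j < k then 1 else 0 := fun j hj => by
    have : ArrayExpr.eval w σ' (.sum 2 (and (le (.var 2) (.var 1)) (.read 2 (.var 2))))
        (Function.update (fun _ => i) 1 j) = 0 ↔ ∀ l < w.length,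
          ¬ (and (le (.var 2) (.var 1)) (.read 2 (.var 2))).Holds w σ'
            (Function.update (Function.update (fun _ => i) 1 j) 2 l) := by
      simp [ArrayExpr.eval, Finset.sum_eq_zero_iff, Holds]
    have h2 : ∀ l < w.length, (ArrayExpr.read 2 (.var 2)).Holds w σ'
            (Function.update (Function.update (fun _ => i) 1 j) 2 l) ↔
            e.Holds w σ (fun _ => l) := fun l hl => by
      simp [Holds, ArrayExpr.eval, hl, σ']
    have h3 : ArrayExpr.eval w σ' (.sum 2 (and (le (.var 2) (.var 1)) (.read 2 (.var 2))))
        (Function.update (fun _ => i) 1 j) = 0 ↔ j < k := by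
      rw [this]
      constructor
      · intro h
        by_contra! hkj
        have := h k (hkj.trans_lt hj)
        rw [holds_and, h2 k (hkj.trans_lt hj)] at this
        exact this ⟨by simpa [ArrayExpr.eval] using hkj, hbig (hkj.trans_lt hj)⟩
      · intro h l hl hh
        rw [holds_and, h2 l hl] at hh
        have hlj : l ≤ j := by simpa [ArrayExpr.eval] using hh.1
        exact hsmall l (hlj.trans_lt h) hh.2
    rw [ArrayExpr.eval]
    by_cases h : j < k
    · rw [if_neg (not_not.2 (h3.2 h)), if_pos h]; rfl
    · rw [if_pos (mt h3.1 h), if_neg h]; rfl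
  rw [ArrayExpr.eval, Finset.sum_congr rfl fun j hj => key j (Finset.mem_range.1 hj),
    Finset.sum_boole, Nat.cast_id]
  have : (Finset.range w.length).filter (· < k) = Finset.range k := by
    ext j
    simp only [Finset.mem_filter, Finset.mem_range]
    omega
  rw [this, Finset.card_range]

/-- Fill array `t` with a vertex that satisfies `e`, if there is one. -/
def find (t : ℕ) (e : ArrayExpr) : ArrayProgram := first t (and (lt (.var 0) size) e)

theorem eval_find {I : BipartiteInstance} {σ : ℕ → ℕ → ℕ} (h : Prepared I σ) (t : ℕ)
    (e : ArrayExpr) : ∃ (f : ℕ → ℕ) (k : ℕ), (find t e).eval I.code σ =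
      Function.update (Function.update σ 2 f) t (fun _ => k) ∧
      ((∃ v : Fin I.n, k = v ∧ e.Holds I.code σ (fun _ => v)) ∨
        I.n ≤ k ∧ ∀ v : Fin I.n, ¬ e.Holds I.code σ (fun _ => v)) := by
  obtain ⟨f, k, heq, hlt, hge⟩ := eval_first I.code σ t (and (lt (.var 0) size) e)
  refine ⟨f, k, heq, ?_⟩
  simp only [holds_and, holds_lt, h.eval_size, ArrayExpr.eval] at hlt hge
  rcases lt_or_ge k I.code.length with hk | hk
  · exact .inl ⟨⟨k, (hlt hk).1.1⟩, rfl, (hlt hk).1.2⟩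
  · refine .inr ⟨?_, fun v hv => hge hk v (BipartiteInstance.lt_length_code v) ⟨v.2, hv⟩⟩
    rw [I.length_code] at hk
    omega

/-- The invariant may mention the round `t`. Combined with a bounded potential that grows in each
round with work left, this shows that the work is finished after the last round. -/
theorem rep_induction {w : List Bool} {P : ArrayProgram} {σ : ℕ → ℕ → ℕ}
    (J : ℕ → (ℕ → ℕ → ℕ) → Prop) (h0 : J 0 σ) (h : ∀ t σ, J t σ → J (t + 1) (P.eval w σ)) :
    J w.length ((rep P).eval w σ) := by
  rw [eval]
  generalize w.length = t
  induction t with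
  | zero => exact h0
  | succ t ih => rw [Function.iterate_succ_apply']; exact h t _ ih

/-- Compute the number of vertices and the positions of the rows of the adjacency matrix. -/
def prepare : ArrayProgram :=
  .seq (first 1 (not (.input (.var 0)))) (.assign 3 (.add (.add size (.const 1))
    (.sum 1 (.cond (lt (.var 1) (.var 0)) size (.const 0)))))

theorem prepared_prepare (I : BipartiteInstance) :
    Prepared I (prepare.eval I.code fun _ _ => 0) ∧
      ∀ a, 3 < a → prepare.eval I.code (fun _ _ => 0) a = fun _ => 0 := by
  obtain ⟨f, k, heq, hlt, hge⟩ := eval_first I.code (fun _ _ => 0) 1 (not (.input (.var 0)))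
  have hlen := I.length_code
  simp only [holds_not] at hlt hge
  simp only [Holds, ArrayExpr.eval, not_not] at hlt hge
  -- The unary prefix ends at the first zero bit of the input.
  have hk : k = I.n := by
    rcases lt_or_ge k I.code.length with hk | hk
    · rcases lt_trichotomy k I.n with h | h | h
      · exact absurd (hlt hk).1 (BipartiteInstance.mem_ofInput_of_lt h)
      · exact h
      · exact absurd BipartiteInstance.mem_ofInput_n ((hlt hk).2 _ h)
    · exact absurd BipartiteInstance.mem_ofInput_n (hge hk I.n (by omega))
  subst hk
  refine ⟨⟨?_, fun u => ?_⟩, fun a ha => ?_⟩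
  · simp [prepare, eval, heq]
  · have hsum : ∑ j ∈ Finset.range I.code.length, (if j < (u : ℕ) then I.n else 0) = u * I.n := by
      rw [← Finset.sum_filter, Finset.sum_const, smul_eq_mul]
      congr 1
      have : (Finset.range I.code.length).filter (· < (u : ℕ)) = Finset.range u := by
        ext j
        have := BipartiteInstance.lt_length_code u
        simp only [Finset.mem_filter, Finset.mem_range]
        omega
      rw [this, Finset.card_range]
    have h0 : 0 < I.code.length := by omega
    rw [← hsum]
    simp [prepare, eval, heq, ArrayExpr.eval, size, lt, h0, Nat.sub_eq_zero_iff_le]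
  · simp [prepare, eval, heq, show a ≠ 1 by omega, show a ≠ 2 by omega, show a ≠ 3 by omega]

end ArrayProgram

/-! ## Two-colouring a bipartite graph -/

namespace ArrayExpr

variable {w : List Bool} {σ : ℕ → ℕ → ℕ} {c e f : ArrayExpr} {ρ : ℕ → ℕ}

theorem eval_cond_of_holds (h : c.Holds w σ ρ) :
    (ArrayExpr.cond c e f).eval w σ ρ = e.eval w σ ρ := if_pos h

theorem eval_cond_of_not_holds (h : ¬ c.Holds w σ ρ) :
    (ArrayExpr.cond c e f).eval w σ ρ = f.eval w σ ρ := if_neg h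

theorem eval_read_vertex {I : BipartiteInstance} {a : ℕ} {v : Fin I.n}
    (h : e.eval I.code σ ρ = v) : (ArrayExpr.read a e).eval I.code σ ρ = σ a v := by
  simp [eval, h, BipartiteInstance.lt_length_code]

theorem eval_read_zero {I : BipartiteInstance} {a : ℕ} :
    (ArrayExpr.read a (.const 0)).eval I.code σ ρ = σ a 0 := by
  have : 0 < I.code.length := by rw [I.length_code]; omega
  simp [eval, this]

theorem holds_read_vertex {I : BipartiteInstance} {a : ℕ} {v : Fin I.n}
    (h : e.eval I.code σ ρ = v) : (ArrayExpr.read a e).Holds I.code σ ρ ↔ σ a v ≠ 0 := by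
  rw [Holds, eval_read_vertex h]

end ArrayExpr

namespace ArrayProgram

open ArrayExpr

/-- Colour an uncoloured vertex of array `4`, preferably one that has a coloured neighbour. -/
def colourStep : ArrayProgram :=
  .seq (find 5 (and (not (.read 4 (.var 0)))
    (ex 1 (and (adj (.var 1) (.var 0)) (.read 4 (.var 1))))))
  (.seq (find 5 (and (not (.read 4 (.var 0)))
    (or (eq (.var 0) (.read 5 (.const 0))) (le size (.read 5 (.const 0))))))
  (.assign 4 (.cond (eq (.var 0) (.read 5 (.const 0)))
    (.cond (ex 1 (and (adj (.var 1) (.var 0)) (eq (.read 4 (.var 1)) (.const 1))))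
      (.const 2) (.const 1)) (.read 4 (.var 0)))))

open Classical in
-- If the first search fails, the coloured set is closed under adjacency, and the second search
-- takes any uncoloured vertex. Otherwise the second search confirms the vertex found. If it fails
-- too, its result is at least `n` and no entry of a vertex changes.
theorem eval_colourStep {I : BipartiteInstance} {σ : ℕ → ℕ → ℕ} (h : Prepared I σ) :
    Prepared I (colourStep.eval I.code σ) ∧
    (∀ a, 5 < a → colourStep.eval I.code σ a = σ a) ∧
    ((∀ v : Fin I.n, σ 4 v ≠ 0) ∧ (∀ v : Fin I.n, colourStep.eval I.code σ 4 v = σ 4 v) ∨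
      ∃ v : Fin I.n, σ 4 v = 0 ∧
        (∀ u : Fin I.n, colourStep.eval I.code σ 4 u = if u = v then
          if ∃ x : Fin I.n, I.graph.Adj x v ∧ σ 4 x = 1 then 2 else 1 else σ 4 u) ∧
        ((∃ u : Fin I.n, I.graph.Adj u v ∧ σ 4 u ≠ 0) ∨
          ∀ u v : Fin I.n, I.graph.Adj u v → σ 4 u ≠ 0 → σ 4 v ≠ 0)) := by
  obtain ⟨f₁, k₁, heq₁, hk₁⟩ := eval_find h 5 (and (not (.read 4 (.var 0)))
    (ex 1 (and (adj (.var 1) (.var 0)) (.read 4 (.var 1)))))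
  set σ₁ := Function.update (Function.update σ 2 f₁) 5 fun _ => k₁ with hσ₁
  have h₁ : Prepared I σ₁ := (h.update (by simp) (by simp) _).update (by simp) (by simp) _
  obtain ⟨f₂, k₂, heq₂, hk₂⟩ := eval_find h₁ 5 (and (not (.read 4 (.var 0)))
    (or (eq (.var 0) (.read 5 (.const 0))) (le size (.read 5 (.const 0)))))
  set σ₂ := Function.update (Function.update σ₁ 2 f₂) 5 fun _ => k₂ with hσ₂
  have h₂ : Prepared I σ₂ := (h₁.update (by simp) (by simp) _).update (by simp) (by simp) _
  have hcol : ∀ u : Fin I.n, colourStep.eval I.code σ 4 u = if (u : ℕ) = k₂ then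
      if ∃ x : Fin I.n, I.graph.Adj x u ∧ σ 4 x = 1 then 2 else 1 else σ 4 u := fun u => by
    simp only [colourStep, eval, heq₁, heq₂, Function.update_self]
    have hc : (eq (.var 0) (.read 5 (.const 0))).Holds I.code σ₂ (fun _ => u) ↔ (u : ℕ) = k₂ := by
      rw [holds_eq, eval_read_zero]; simp [ArrayExpr.eval, hσ₂]
    have hc' : (ex 1 (and (adj (.var 1) (.var 0)) (eq (.read 4 (.var 1)) (.const 1)))).Holds I.code
        σ₂ (fun _ => u) ↔ ∃ x : Fin I.n, I.graph.Adj x u ∧ σ 4 x = 1 := by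
      rw [h₂.holds_ex]
      refine exists_congr fun x => ?_
      rw [holds_and, holds_eq, h₂.holds_adj_of_eval_eq (u := x) (v := u) (by simp [ArrayExpr.eval])
        (by simp [ArrayExpr.eval]), eval_read_vertex (v := x) (by simp [ArrayExpr.eval])]
      simp [ArrayExpr.eval, hσ₁, hσ₂]
    split_ifs with h1 h2
    · rw [eval_cond_of_holds (hc.2 h1), eval_cond_of_holds (hc'.2 h2)]; rfl
    · rw [eval_cond_of_holds (hc.2 h1), eval_cond_of_not_holds (mt hc'.1 h2)]; rfl
    · rw [eval_cond_of_not_holds (mt hc.1 h1), eval_read_vertex (v := u) rfl]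
      simp [hσ₁, hσ₂]
  refine ⟨?_, fun a ha => ?_, ?_⟩
  · simp only [colourStep, eval, heq₁, heq₂]
    exact h₂.update (by simp) (by simp) _
  · simp only [colourStep, eval, heq₁, heq₂]
    simp [hσ₁, hσ₂, show a ≠ 4 by omega, show a ≠ 5 by omega, show a ≠ 2 by omega]
  have hp₁ : ∀ v : Fin I.n, (and (not (.read 4 (.var 0))) (ex 1 (and (adj (.var 1) (.var 0))
      (.read 4 (.var 1))))).Holds I.code σ (fun _ => v) ↔
      σ 4 v = 0 ∧ ∃ u : Fin I.n, I.graph.Adj u v ∧ σ 4 u ≠ 0 := fun v => by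
    rw [holds_and, holds_not, holds_read_vertex (v := v) rfl, h.holds_ex, not_not]
    refine and_congr_right fun _ => exists_congr fun x => ?_
    rw [holds_and, h.holds_adj_of_eval_eq (u := x) (v := v) (by simp [ArrayExpr.eval])
        (by simp [ArrayExpr.eval]), holds_read_vertex (v := x) (by simp [ArrayExpr.eval])]
  have hp₂ : ∀ v : Fin I.n, (and (not (.read 4 (.var 0))) (or (eq (.var 0) (.read 5 (.const 0)))
      (le size (.read 5 (.const 0))))).Holds I.code σ₁ (fun _ => v) ↔
      σ 4 v = 0 ∧ ((v : ℕ) = k₁ ∨ I.n ≤ k₁) := fun v => by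
    rw [holds_and, holds_not, holds_read_vertex (v := v) rfl, holds_or, holds_eq, holds_le,
      eval_read_zero, h₁.eval_size]
    simp [ArrayExpr.eval, hσ₁]
  simp only [hp₁] at hk₁
  simp only [hp₂] at hk₂
  rcases hk₂ with ⟨v, rfl, hv0, hv⟩ | ⟨hk₂, hnone⟩
  · refine .inr ⟨v, hv0, fun u => ?_, ?_⟩
    · rw [hcol u]
      by_cases huv : u = v
      · subst huv; rw [if_pos rfl, if_pos rfl]
      · rw [if_neg (fun h => huv (Fin.ext h)), if_neg huv]
    · rcases hk₁ with ⟨v', rfl, hv'⟩ | ⟨hk₁, hnone⟩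
      · have : v = v' := by
          rcases hv with h | h
          · exact Fin.ext h
          · exact absurd v'.2 (not_lt.2 h)
        exact .inl (this ▸ hv'.2)
      · exact .inr fun x y hxy hx hy => hnone y ⟨hy, x, hxy, hx⟩
  · refine .inl ⟨fun v hv => ?_, fun v => ?_⟩
    · rcases hk₁ with ⟨v', rfl, hv'⟩ | ⟨hk₁, -⟩
      · exact hnone v' ⟨hv'.1, .inl rfl⟩
      · exact hnone v ⟨hv, .inr hk₁⟩
    · rw [hcol, if_neg (by have := v.2; omega)]

/-- The colouring `c`, with `0` for uncoloured vertices, is part of a proper colouring. -/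
def IsPartialColouring {V : Type*} (G : SimpleGraph V) (c : V → ℕ) : Prop :=
  ∃ χ : V → Prop, (∀ u v, G.Adj u v → (χ u ↔ ¬ χ v)) ∧ ∀ v, c v ≠ 0 → (c v = 1 ↔ χ v)

open Classical in
-- A coloured neighbour forces the colour of `v`, and the same `χ` works. Without one, the coloured
-- vertices form a union of components, so `χ` may be flipped on all the others to give `v` colour
-- `1`.
theorem IsPartialColouring.step {V : Type*} {G : SimpleGraph V} {c : V → ℕ}
    (hc : IsPartialColouring G c) {v : V} (hv : c v = 0)
    (h : (∃ u, G.Adj u v ∧ c u ≠ 0) ∨ ∀ u v, G.Adj u v → c u ≠ 0 → c v ≠ 0) :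
    IsPartialColouring G fun u => if u = v then
      if ∃ x, G.Adj x v ∧ c x = 1 then 2 else 1 else c u := by
  obtain ⟨χ, hχ, hcχ⟩ := hc
  by_cases hnb : ∃ u, G.Adj u v ∧ c u ≠ 0
  · refine ⟨χ, hχ, fun u hu => ?_⟩
    by_cases huv : u = v
    · subst huv
      beta_reduce
      rw [if_pos rfl]
      split_ifs with h1
      · obtain ⟨x, hx, hx1⟩ := h1
        have := (hcχ x (by omega)).1 hx1
        have := hχ x u hx
        simp; tauto
      · obtain ⟨x, hx, hx0⟩ := hnb
        have hx1 : c x ≠ 1 := fun hx1 => h1 ⟨x, hx, hx1⟩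
        have := mt (hcχ x hx0).2 hx1
        have := hχ x u hx
        simp; tauto
    · simp only [huv, if_false] at hu ⊢
      exact hcχ u hu
  · have hclosed := h.resolve_left hnb
    have h1 : ¬ ∃ x, G.Adj x v ∧ c x = 1 := fun ⟨x, hx, hx1⟩ => hnb ⟨x, hx, by omega⟩
    refine ⟨fun u => if c u ≠ 0 then χ u else if χ v then χ u else ¬ χ u, fun u x hux => ?_,
      fun u hu => ?_⟩
    · have := hclosed u x hux
      have := hclosed x u hux.symm
      have := hχ u x hux
      by_cases h2 : c u = 0 <;> by_cases h3 : c x = 0 <;> by_cases h4 : χ v <;>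
        simp [h2, h3, h4] <;> tauto
    · by_cases huv : u = v
      · subst huv
        simp [h1, hv]
      · simp only [huv, if_false] at hu ⊢
        simp only [hu, ne_eq, not_false_eq_true, if_true]
        exact hcχ u hu

/-- Colour all vertices, one after the other. -/
def colour : ArrayProgram := .rep colourStep

/-- The potential is the number of coloured vertices, which cannot reach the input length. -/
theorem eval_colour {I : BipartiteInstance} {σ : ℕ → ℕ → ℕ} (h : Prepared I σ)
    (h4 : ∀ v : Fin I.n, σ 4 v = 0) :
    Prepared I (colour.eval I.code σ) ∧ (∀ a, 5 < a → colour.eval I.code σ a = σ a) ∧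
      ∀ u v : Fin I.n, I.graph.Adj u v →
        (colour.eval I.code σ 4 u = 1 ↔ ¬ colour.eval I.code σ 4 v = 1) := by
  classical
  obtain ⟨h1, h2, ⟨χ, hχ, hc⟩, h3⟩ := rep_induction (w := I.code) (P := colourStep) (σ := σ)
    (fun t σ' => Prepared I σ' ∧ (∀ a, 5 < a → σ' a = σ a) ∧
      IsPartialColouring I.graph (fun v : Fin I.n => σ' 4 v) ∧
      (t ≤ (Finset.univ.filter fun v : Fin I.n => σ' 4 v ≠ 0).card ∨ ∀ v : Fin I.n, σ' 4 v ≠ 0))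
    ⟨h, fun _ _ => rfl, by
      obtain ⟨c⟩ := I.bipartite
      refine ⟨fun v => c v = 0, fun u v huv => ?_, fun v hv => absurd (h4 v) hv⟩
      have := c.valid huv
      omega, .inl (Nat.zero_le _)⟩
    (by
      rintro t σ' ⟨h1, h2, h3, h4⟩
      obtain ⟨h1', h2', h⟩ := eval_colourStep h1
      refine ⟨h1', fun a ha => (h2' a ha).trans (h2 a ha), ?_⟩
      rcases h with ⟨hall, heq⟩ | ⟨v, hv, heq, hv'⟩
      · simp only [heq]
        exact ⟨h3, .inr hall⟩
      · simp only [heq]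
        refine ⟨by convert h3.step hv hv', .inl ?_⟩
        have ht := h4.resolve_right (fun h => h v hv)
        refine Nat.succ_le_of_lt (ht.trans_lt (Finset.card_lt_card ?_))
        refine Finset.ssubset_iff_of_subset (fun u hu => ?_) |>.2 ⟨v, ?_, by simp [hv]⟩
        · simp only [Finset.mem_filter, Finset.mem_univ, true_and] at hu ⊢
          split_ifs <;> simp [hu]
        · simp only [Finset.mem_filter, Finset.mem_univ, true_and, if_true]
          split_ifs <;> simp)
  have hall : ∀ v : Fin I.n, (rep colourStep).eval I.code σ 4 v ≠ 0 := by
    refine h3.resolve_left fun hle => ?_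
    have := hle.trans (Finset.card_filter_le _ _)
    rw [I.length_code, Finset.card_univ, Fintype.card_fin] at this
    omega
  exact ⟨h1, h2, fun u v huv => by
    have := hc u (hall u)
    have := hc v (hall v)
    have := hχ u v huv
    simp only [colour]
    tauto⟩

end ArrayProgram

/-! ## Matching by auction -/

/-- The invariant of the auction between the vertices of colour `1` and their neighbours: `d` are the
labels, and `m y = i x + 1` if `y` is matched to `x`. -/
structure AuctionInvariant {V : Type*} (G : SimpleGraph V) (A : V → Prop) (N : ℕ) (i : V → ℕ)
    (d m : V → ℕ) : Prop where
  exists_of_pos : ∀ y, 0 < d y → ∃ x, m y = i x + 1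
  adj : ∀ y x, m y = i x + 1 → A x ∧ G.Adj x y
  label_le : ∀ y x, m y = i x + 1 → ∀ y', G.Adj x y' → d y ≤ d y' + 1
  inj : ∀ y y' x, m y = i x + 1 → m y' = i x + 1 → y = y'
  le : ∀ y, d y ≤ N + 1

/-- The new label of `y` is one more than the old minimum around `x`, so `label_le` holds for the
new pair; for the other pairs, raising a label only helps. A labelled vertex may change its partner
but never loses one without replacement. -/
theorem AuctionInvariant.step {V : Type*} [DecidableEq V] {G : SimpleGraph V} {A : V → Prop}
    {N : ℕ} {i : V → ℕ} (hi : Function.Injective i) {d m : V → ℕ} (h : AuctionInvariant G A N i d m)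
    {x y : V} (hx : A x) (hxm : ∀ y, m y ≠ i x + 1) (hxy : G.Adj x y)
    (hmin : ∀ y', G.Adj x y' → d y ≤ d y') (hle : d y ≤ N) :
    AuctionInvariant G A N i (fun u => if u = y then d u + 1 else d u)
      (fun u => if u = y then i x + 1 else m u) where
  exists_of_pos u hu := by
    by_cases huy : u = y
    · exact ⟨x, by simp [huy]⟩
    · simp only [huy, if_false] at hu ⊢
      exact h.exists_of_pos u hu
  adj u z huz := by
    by_cases huy : u = y
    · simp only [huy, if_true, Nat.add_right_cancel_iff] at huz ⊢
      exact hi huz ▸ ⟨hx, hxy⟩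
    · simp only [huy, if_false] at huz
      exact h.adj u z huz
  label_le u z huz y' hy' := by
    have hge : d y' ≤ if y' = y then d y' + 1 else d y' := by split_ifs <;> omega
    refine le_trans ?_ (Nat.add_le_add_right hge 1)
    by_cases huy : u = y
    · simp only [huy, if_true, Nat.add_right_cancel_iff] at huz ⊢
      have := hmin y' (hi huz ▸ hy')
      omega
    · simp only [huy, if_false] at huz ⊢
      exact h.label_le u z huz y' hy'
  inj u u' z huz hu'z := by
    by_cases huy : u = y <;> by_cases hu'y : u' = y
    · rw [huy, hu'y]
    · simp only [huy, hu'y, if_true, if_false, Nat.add_right_cancel_iff] at huz hu'z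
      exact absurd (huz ▸ hu'z) (hxm u')
    · simp only [huy, hu'y, if_true, if_false, Nat.add_right_cancel_iff] at huz hu'z
      exact absurd (hu'z ▸ huz) (hxm u)
    · simp only [huy, hu'y, if_false] at huz hu'z
      exact h.inj u u' z huz hu'z
  le u := by
    by_cases huy : u = y
    · simp only [huy, if_true]; omega
    · simp only [huy, if_false]; exact h.le u

namespace ArrayProgram

open ArrayExpr

/-- An unmatched vertex of colour `1` with a neighbour of label at most the number of vertices is
matched to a neighbour of least label, which is then increased. -/
def auctionStep : ArrayProgram :=
  .seq (find 8 (and (eq (.read 4 (.var 0)) (.const 1))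
    (and (all 1 (not (eq (.read 7 (.var 1)) (.add (.var 0) (.const 1)))))
      (ex 1 (and (adj (.var 0) (.var 1)) (le (.read 6 (.var 1)) size))))))
  (.seq (find 9 (and (adj (.read 8 (.const 0)) (.var 0))
    (all 1 (or (not (adj (.read 8 (.const 0)) (.var 1)))
      (le (.read 6 (.var 0)) (.read 6 (.var 1)))))))
  (.seq (.assign 7 (.cond (eq (.var 0) (.read 9 (.const 0)))
    (.add (.read 8 (.const 0)) (.const 1)) (.read 7 (.var 0))))
  (.assign 6 (.cond (eq (.var 0) (.read 9 (.const 0)))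
    (.add (.read 6 (.var 0)) (.const 1)) (.read 6 (.var 0))))))

open Classical in
theorem eval_auctionStep {I : BipartiteInstance} {σ : ℕ → ℕ → ℕ} (h : Prepared I σ) :
    Prepared I (auctionStep.eval I.code σ) ∧ auctionStep.eval I.code σ 4 = σ 4 ∧
    ((∀ x : Fin I.n, σ 4 x = 1 → (∀ y : Fin I.n, σ 7 y ≠ x + 1) →
        ∀ y : Fin I.n, I.graph.Adj x y → I.n < σ 6 y) ∧
      (∀ v : Fin I.n, auctionStep.eval I.code σ 6 v = σ 6 v) ∧
      (∀ v : Fin I.n, auctionStep.eval I.code σ 7 v = σ 7 v) ∨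
    ∃ x y : Fin I.n, σ 4 x = 1 ∧ (∀ y : Fin I.n, σ 7 y ≠ x + 1) ∧ I.graph.Adj x y ∧
      (∀ y' : Fin I.n, I.graph.Adj x y' → σ 6 y ≤ σ 6 y') ∧ σ 6 y ≤ I.n ∧
      (∀ v : Fin I.n, auctionStep.eval I.code σ 6 v = if v = y then σ 6 v + 1 else σ 6 v) ∧
      (∀ v : Fin I.n, auctionStep.eval I.code σ 7 v = if v = y then (x : ℕ) + 1 else σ 7 v)) := by
  obtain ⟨f₁, k₁, heq₁, hk₁⟩ := eval_find h 8 (and (eq (.read 4 (.var 0)) (.const 1))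
    (and (all 1 (not (eq (.read 7 (.var 1)) (.add (.var 0) (.const 1)))))
      (ex 1 (and (adj (.var 0) (.var 1)) (le (.read 6 (.var 1)) size)))))
  set σ₁ := Function.update (Function.update σ 2 f₁) 8 fun _ => k₁ with hσ₁
  have h₁ : Prepared I σ₁ := (h.update (by simp) (by simp) _).update (by simp) (by simp) _
  obtain ⟨f₂, k₂, heq₂, hk₂⟩ := eval_find h₁ 9 (and (adj (.read 8 (.const 0)) (.var 0))
    (all 1 (or (not (adj (.read 8 (.const 0)) (.var 1)))
      (le (.read 6 (.var 0)) (.read 6 (.var 1))))))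
  set σ₂ := Function.update (Function.update σ₁ 2 f₂) 9 fun _ => k₂ with hσ₂
  have h₂ : Prepared I σ₂ := (h₁.update (by simp) (by simp) _).update (by simp) (by simp) _
  -- Stated for any `τ`, since the second assignment is evaluated after array `7` has changed.
  have hc (τ : ℕ → ℕ → ℕ) (hτ : τ 9 = fun _ => k₂) (u : ℕ) :
      (eq (.var 0) (.read 9 (.const 0))).Holds I.code τ (fun _ => u) ↔ u = k₂ := by
    rw [holds_eq, eval_read_zero]; simp [ArrayExpr.eval, hτ]
  have hm : ∀ v : Fin I.n, auctionStep.eval I.code σ 7 v =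
      if (v : ℕ) = k₂ then k₁ + 1 else σ 7 v := fun v => by
    simp only [auctionStep, eval, heq₁, heq₂]
    rw [Function.update_of_ne (by simp), Function.update_self]
    split_ifs with h1
    · rw [eval_cond_of_holds ((hc σ₂ (by simp [hσ₂]) _).2 h1), ArrayExpr.eval, eval_read_zero]
      simp [ArrayExpr.eval, hσ₁, hσ₂]
    · rw [eval_cond_of_not_holds (mt (hc σ₂ (by simp [hσ₂]) _).1 h1), eval_read_vertex (v := v) rfl]
      simp [hσ₁, hσ₂]
  have hd : ∀ v : Fin I.n, auctionStep.eval I.code σ 6 v =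
      if (v : ℕ) = k₂ then σ 6 v + 1 else σ 6 v := fun v => by
    simp only [auctionStep, eval, heq₁, heq₂]
    rw [Function.update_self]
    split_ifs with h1
    · rw [eval_cond_of_holds ((hc _ (by simp [hσ₂]) _).2 h1), ArrayExpr.eval,
        eval_read_vertex (v := v) rfl]
      simp [ArrayExpr.eval, hσ₁, hσ₂]
    · rw [eval_cond_of_not_holds (mt (hc _ (by simp [hσ₂]) _).1 h1), eval_read_vertex (v := v) rfl]
      simp [hσ₁, hσ₂]
  refine ⟨?_, ?_, ?_⟩
  · simp only [auctionStep, eval, heq₁, heq₂]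
    exact (h₂.update (by simp) (by simp) _).update (by simp) (by simp) _
  · simp only [auctionStep, eval, heq₁, heq₂]
    simp [hσ₁, hσ₂]
  have hp₁ : ∀ v : Fin I.n, (and (eq (.read 4 (.var 0)) (.const 1))
      (and (all 1 (not (eq (.read 7 (.var 1)) (.add (.var 0) (.const 1)))))
      (ex 1 (and (adj (.var 0) (.var 1)) (le (.read 6 (.var 1)) size))))).Holds I.code σ
      (fun _ => v) ↔ σ 4 v = 1 ∧ (∀ y : Fin I.n, σ 7 y ≠ v + 1) ∧
        ∃ y : Fin I.n, I.graph.Adj v y ∧ σ 6 y ≤ I.n := fun v => by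
    rw [holds_and, holds_eq, eval_read_vertex (v := v) rfl, holds_and, h.holds_all, h.holds_ex]
    refine and_congr Iff.rfl (and_congr (forall_congr' fun y => ?_) (exists_congr fun y => ?_))
    · rw [holds_not, holds_eq, eval_read_vertex (v := y) (by simp [ArrayExpr.eval])]
      simp [ArrayExpr.eval]
    · rw [holds_and, h.holds_adj_of_eval_eq (u := v) (v := y) (by simp [ArrayExpr.eval])
        (by simp [ArrayExpr.eval]), holds_le, eval_read_vertex (v := y) (by simp [ArrayExpr.eval]),
        h.eval_size]
  have hp₂ : ∀ x v : Fin I.n, k₁ = x → ((and (adj (.read 8 (.const 0)) (.var 0))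
      (all 1 (or (not (adj (.read 8 (.const 0)) (.var 1)))
      (le (.read 6 (.var 0)) (.read 6 (.var 1)))))).Holds I.code σ₁ (fun _ => v) ↔
      I.graph.Adj x v ∧ ∀ y : Fin I.n, I.graph.Adj x y → σ 6 v ≤ σ 6 y) := fun x v hx => by
    have hX : ∀ ρ, (ArrayExpr.read 8 (.const 0)).eval I.code σ₁ ρ = x := fun ρ => by
      rw [eval_read_zero]; simp [hσ₁, hx]
    rw [holds_and, h₁.holds_all, h₁.holds_adj_of_eval_eq (u := x) (v := v) (hX _) rfl]
    refine and_congr Iff.rfl (forall_congr' fun y => ?_)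
    rw [holds_or, holds_not, h₁.holds_adj_of_eval_eq (u := x) (v := y) (hX _)
      (by simp [ArrayExpr.eval]), holds_le, eval_read_vertex (v := v) (by simp [ArrayExpr.eval]),
      eval_read_vertex (v := y) (by simp [ArrayExpr.eval]), ← imp_iff_not_or]
    simp [hσ₁]
  simp only [hp₁] at hk₁
  rcases hk₁ with ⟨x, hkx, hx, hxm, y₀, hy₀, hle⟩ | ⟨hk₁, hnone⟩
  · simp only [fun v => hp₂ x v hkx] at hk₂
    rcases hk₂ with ⟨y, hky, hxy, hmin⟩ | ⟨-, hno⟩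
    · have hiff : ∀ v : Fin I.n, (v : ℕ) = k₂ ↔ v = y := fun v => by rw [hky, Fin.ext_iff]
      refine .inr ⟨x, y, hx, hxm, hxy, hmin, (hmin y₀ hy₀).trans hle, fun v => ?_, fun v => ?_⟩
      · simp only [hd, hiff]
      · simp only [hm, hiff, hkx]
    · obtain ⟨y, hy, hmin⟩ := Finset.exists_min_image
        (Finset.univ.filter fun y : Fin I.n => I.graph.Adj x y) (fun y => σ 6 y)
        ⟨y₀, by simpa using hy₀⟩
      simp only [Finset.mem_filter, Finset.mem_univ, true_and] at hy hmin
      exact absurd ⟨hy, hmin⟩ (hno y)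
  -- Without a bidder, array `8` holds no vertex, so the second search fails as well and both
  -- assignments leave the entries of vertices alone.
  · have hk₂' : I.n ≤ k₂ := by
      rcases hk₂ with ⟨y, -, hy⟩ | ⟨h, -⟩
      · rw [holds_and, h₁.holds_adj] at hy
        obtain ⟨⟨x, -, hx, -⟩, -⟩ := hy
        rw [eval_read_zero] at hx
        have := x.2
        simp [hσ₁] at hx
        omega
      · exact h
    have hne : ∀ v : Fin I.n, (v : ℕ) ≠ k₂ := fun v => by have := v.2; omega
    refine .inl ⟨fun x hx hxm y hxy => ?_, fun v => ?_, fun v => ?_⟩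
    · by_contra! hle
      exact hnone x ⟨hx, hxm, y, hxy, hle⟩
    · rw [hd, if_neg (hne v)]
    · rw [hm, if_neg (hne v)]

/-- Match vertices of colour `1` until no step is possible. -/
def auction : ArrayProgram := .rep auctionStep

/-- Every bid raises the sum of the labels by one. Labels are at most `n + 1`, so the sum is at most
`n * (n + 1)`, one less than the number of rounds; the auction has therefore stopped by the end. -/
theorem eval_auction {I : BipartiteInstance} {σ : ℕ → ℕ → ℕ} (h : Prepared I σ)
    (h6 : ∀ v : Fin I.n, σ 6 v = 0) (h7 : ∀ v : Fin I.n, σ 7 v = 0) :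
    Prepared I (auction.eval I.code σ) ∧ auction.eval I.code σ 4 = σ 4 ∧
      AuctionInvariant I.graph (fun v : Fin I.n => σ 4 v = 1) I.n Fin.val
        (fun v => auction.eval I.code σ 6 v) (fun v => auction.eval I.code σ 7 v) ∧
      ∀ x : Fin I.n, σ 4 x = 1 → (∀ y : Fin I.n, auction.eval I.code σ 7 y ≠ x + 1) →
        ∀ y : Fin I.n, I.graph.Adj x y → I.n < auction.eval I.code σ 6 y := by
  obtain ⟨h1, h2, h3, h4⟩ := rep_induction (w := I.code) (P := auctionStep) (σ := σ)
    (fun t σ' => Prepared I σ' ∧ σ' 4 = σ 4 ∧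
      AuctionInvariant I.graph (fun v : Fin I.n => σ 4 v = 1) I.n Fin.val
        (fun v => σ' 6 v) (fun v => σ' 7 v) ∧
      (t ≤ ∑ v : Fin I.n, σ' 6 v ∨ ∀ x : Fin I.n, σ 4 x = 1 →
        (∀ y : Fin I.n, σ' 7 y ≠ x + 1) → ∀ y : Fin I.n, I.graph.Adj x y → I.n < σ' 6 y))
    ⟨h, rfl, by constructor <;> simp [h6, h7], .inl (Nat.zero_le _)⟩
    (by
      rintro t σ' ⟨h1, h2, h3, h4⟩
      obtain ⟨h1', h2', h⟩ := eval_auctionStep h1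
      rw [h2] at h2' h
      refine ⟨h1', h2', ?_⟩
      rcases h with ⟨hdone, hd, hm⟩ | ⟨x, y, hx, hxm, hxy, hmin, hle, hd, hm⟩
      · simp only [hd, hm]
        exact ⟨h3, .inr hdone⟩
      · have ht := h4.resolve_right fun h => by have := h x hx hxm y hxy; omega
        refine ⟨?_, .inl ?_⟩
        · have := h3.step Fin.val_injective hx hxm hxy hmin hle
          simp only [hd, hm]
          convert this
        · refine Nat.succ_le_of_lt (ht.trans_lt (Finset.sum_lt_sum (fun v _ => ?_) ⟨y, by simp, ?_⟩))
          · rw [hd]; split_ifs <;> omega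
          · rw [hd, if_pos rfl]; omega)
  refine ⟨h1, h2, h3, h4.resolve_left fun hle => ?_⟩
  have := hle.trans (Finset.sum_le_card_nsmul _ _ (I.n + 1) fun v _ => h3.le v)
  rw [I.length_code, Finset.card_univ, Fintype.card_fin, smul_eq_mul, mul_add, mul_one] at this
  omega

end ArrayProgram

/-! ## The algorithm -/

namespace ArrayProgram

open ArrayExpr

/-- Write to array `12` the stable set given by a gap in the labels of the auction. -/
def gapSet : ArrayProgram :=
  .seq (first 10 (and (lt (.const 0) (.var 0)) (all 1 (not (eq (.read 6 (.var 1)) (.var 0))))))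
  (.assign 12 (or
    (and (eq (.read 4 (.var 0)) (.const 1)) (all 1 (or (not (adj (.var 0) (.var 1)))
      (le (.read 10 (.const 0)) (.read 6 (.var 1))))))
    (and (not (eq (.read 4 (.var 0)) (.const 1)))
      (lt (.read 6 (.var 0)) (.read 10 (.const 0))))))

/-- By pigeonhole, `n` labels cannot cover the `n + 1` values `1, …, n + 1`. The bound `K ≤ n + 1`
puts `K` below the labels around unmatched vertices of colour `1`. -/
theorem eval_gapSet {I : BipartiteInstance} {σ : ℕ → ℕ → ℕ} (h : Prepared I σ) :
    Prepared I (gapSet.eval I.code σ) ∧ ∃ K, 0 < K ∧ (0 < I.n → K ≤ I.n + 1) ∧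
      (∀ v : Fin I.n, σ 6 v ≠ K) ∧ ∀ v : Fin I.n, gapSet.eval I.code σ 12 v ≠ 0 ↔
        (σ 4 v = 1 ∧ ∀ y : Fin I.n, I.graph.Adj v y → K ≤ σ 6 y) ∨ (¬ σ 4 v = 1 ∧ σ 6 v < K) := by
  obtain ⟨f, k, heq, hlt, hge⟩ := eval_first I.code σ 10 (and (lt (.const 0) (.var 0))
    (all 1 (not (eq (.read 6 (.var 1)) (.var 0)))))
  set σ₁ := Function.update (Function.update σ 2 f) 10 fun _ => k with hσ₁
  have h₁ : Prepared I σ₁ := (h.update (by simp) (by simp) _).update (by simp) (by simp) _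
  have hp : ∀ j, (and (lt (.const 0) (.var 0)) (all 1 (not (eq (.read 6 (.var 1))
      (.var 0))))).Holds I.code σ (fun _ => j) ↔ 0 < j ∧ ∀ v : Fin I.n, σ 6 v ≠ j := fun j => by
    rw [holds_and, h.holds_all, holds_lt]
    refine and_congr Iff.rfl (forall_congr' fun v => ?_)
    rw [holds_not, holds_eq, eval_read_vertex (v := v) (by simp [ArrayExpr.eval])]
    simp [ArrayExpr.eval]
  simp only [hp] at hlt hge
  have hlen := I.length_code
  have hgap : ∃ j, 0 < j ∧ j ≤ I.n + 1 ∧ ∀ v : Fin I.n, σ 6 v ≠ j := by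
    by_contra! hcon
    have hsub : Finset.Icc 1 (I.n + 1) ⊆ Finset.univ.image fun v : Fin I.n => σ 6 v := fun j hj => by
      obtain ⟨v, hv⟩ := hcon j (Finset.mem_Icc.1 hj).1 (Finset.mem_Icc.1 hj).2
      exact Finset.mem_image.2 ⟨v, Finset.mem_univ v, hv⟩
    have := (Finset.card_le_card hsub).trans Finset.card_image_le
    simp at this
  obtain ⟨j, hj0, hj, hjv⟩ := hgap
  have hk : 0 < k ∧ (0 < I.n → k ≤ I.n + 1) ∧ ∀ v : Fin I.n, σ 6 v ≠ k := by
    rcases lt_or_ge k I.code.length with hk | hk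
    · refine ⟨(hlt hk).1.1, fun _ => ?_, (hlt hk).1.2⟩
      by_contra! hcon
      exact (hlt hk).2 j (by omega) ⟨hj0, hjv⟩
    -- The search covers indices below `n * n + n + 1`, which include `n + 1` unless the graph is
    -- empty.
    · have hn : I.n = 0 := by
        by_contra hn
        have : I.n ≤ I.n * I.n := Nat.le_mul_self _
        have hjl : j < I.code.length ∨ I.n = 1 ∧ j = 2 := by
          rcases Nat.lt_or_ge 1 I.n with h | h
          · left; nlinarith
          · omega
        rcases hjl with hjl | hjl
        · exact hge hk j hjl ⟨hj0, hjv⟩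
        · rw [hjl.1] at hlen
          exact hge hk j (by omega) ⟨hj0, hjv⟩
      refine ⟨by omega, fun h => by omega, fun v => absurd v.2 (by omega)⟩
  refine ⟨?_, k, hk.1, hk.2.1, hk.2.2, fun v => ?_⟩
  · simp only [gapSet, eval, heq]
    exact h₁.update (by simp) (by simp) _
  · have hK : ∀ ρ, (ArrayExpr.read 10 (.const 0)).eval I.code σ₁ ρ = k := fun ρ => by
      rw [eval_read_zero]; simp [hσ₁]
    simp only [gapSet, eval, heq, Function.update_self]
    rw [← Holds, holds_or, holds_and, holds_and, h₁.holds_all, holds_not, holds_eq,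
      eval_read_vertex (v := v) rfl, holds_lt, eval_read_vertex (v := v) rfl, hK]
    have : ∀ y : Fin I.n, (or (not (adj (.var 0) (.var 1))) (le (.read 10 (.const 0))
        (.read 6 (.var 1)))).Holds I.code σ₁ (Function.update (fun _ => (v : ℕ)) 1 y) ↔
        (I.graph.Adj v y → k ≤ σ 6 y) := fun y => by
      rw [holds_or, holds_not, h₁.holds_adj_of_eval_eq (u := v) (v := y) (by simp [ArrayExpr.eval])
        (by simp [ArrayExpr.eval]), holds_le, hK,
        eval_read_vertex (v := y) (by simp [ArrayExpr.eval]), ← imp_iff_not_or]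
      simp [hσ₁]
    simp only [this]
    simp [hσ₁, ArrayExpr.eval]

/-- Write the chosen leaves to array `11`. -/
def chosenLeaves : ArrayProgram :=
  .assign 11 (and (unique 1 (adj (.var 0) (.var 1))) (all 1 (or (not (adj (.var 0) (.var 1)))
    (or (not (unique 2 (adj (.var 1) (.var 2)))) (lt (.var 0) (.var 1))))))

theorem eval_chosenLeaves {I : BipartiteInstance} {σ : ℕ → ℕ → ℕ} (h : Prepared I σ) (v : Fin I.n) :
    chosenLeaves.eval I.code σ 11 v ≠ 0 ↔ IsChosenLeaf I.graph v := by
  simp only [chosenLeaves, eval, Function.update_self]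
  rw [← Holds, holds_and, h.holds_unique, h.holds_all, IsChosenLeaf]
  refine and_congr (existsUnique_congr fun u => ?_) (forall_congr' fun u => ?_)
  · exact h.holds_adj_of_eval_eq (by simp [ArrayExpr.eval]) (by simp [ArrayExpr.eval])
  · rw [holds_or, holds_not, h.holds_adj_of_eval_eq (u := v) (v := u) (by simp [ArrayExpr.eval])
      (by simp [ArrayExpr.eval]), ← imp_iff_not_or, holds_or, holds_not, holds_lt, h.holds_unique]
    refine imp_congr_right fun _ => or_congr (not_congr (existsUnique_congr fun x => ?_)) ?_
    · exact h.holds_adj_of_eval_eq (by simp [ArrayExpr.eval]) (by simp [ArrayExpr.eval])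
    · simp [ArrayExpr.eval]

/-- Write to array `0` the set in array `11` if every vertex outside of it has exactly one neighbour
in it, and the set in array `12` otherwise. -/
def output : ArrayProgram :=
  .assign 0 (.cond (all 1 (or (.read 11 (.var 1))
    (unique 2 (and (adj (.var 1) (.var 2)) (.read 11 (.var 2))))))
    (.read 11 (.var 0)) (.read 12 (.var 0)))

open Classical in
theorem eval_output {I : BipartiteInstance} {σ : ℕ → ℕ → ℕ} (h : Prepared I σ) (v : Fin I.n) :
    output.eval I.code σ 0 v =
      if ∀ v : Fin I.n, σ 11 v ≠ 0 ∨ ∃! u : Fin I.n, I.graph.Adj v u ∧ σ 11 u ≠ 0 then σ 11 v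
      else σ 12 v := by
  simp only [output, eval, Function.update_self]
  have hc : (all 1 (or (.read 11 (.var 1)) (unique 2 (and (adj (.var 1) (.var 2))
      (.read 11 (.var 2)))))).Holds I.code σ (fun _ => v) ↔
      ∀ v : Fin I.n, σ 11 v ≠ 0 ∨ ∃! u : Fin I.n, I.graph.Adj v u ∧ σ 11 u ≠ 0 := by
    rw [h.holds_all]
    refine forall_congr' fun u => ?_
    rw [holds_or, holds_read_vertex (v := u) (by simp [ArrayExpr.eval]), h.holds_unique]
    refine or_congr Iff.rfl (existsUnique_congr fun x => ?_)
    rw [holds_and, holds_read_vertex (v := x) (by simp [ArrayExpr.eval]),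
      h.holds_adj_of_eval_eq (u := u) (v := x) (by simp [ArrayExpr.eval])
      (by simp [ArrayExpr.eval])]
  split_ifs with h1
  · rw [eval_cond_of_holds (hc.2 h1), eval_read_vertex (v := v) rfl]
  · rw [eval_cond_of_not_holds (mt hc.1 h1), eval_read_vertex (v := v) rfl]

/-- Compute a maximum stable set of a bipartite graph that is repairable if possible. -/
def robustStableSet : ArrayProgram :=
  .seq prepare (.seq colour (.seq auction (.seq gapSet (.seq chosenLeaves output))))

/-- If the chosen leaves pass the test, they are the answer. If not, no repairable maximum stable
set exists, and the gap set only has to be maximum. -/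
theorem exists_eval_robustStableSet (I : BipartiteInstance) : ∃ S : Finset (Fin I.n),
    I.graph.IsMaximumIndepSet S ∧ ((∃ T : Finset (Fin I.n), IsRepairableMaximumStable I.graph T) →
      IsRepairable (IsStable I.graph) S) ∧
    robustStableSet.eval I.code (fun _ _ => 0) 1 0 = I.n ∧
    ∀ v : Fin I.n, robustStableSet.eval I.code (fun _ _ => 0) 0 v ≠ 0 ↔ v ∈ S := by
  classical
  obtain ⟨h₁, hz₁⟩ := prepared_prepare I
  have heval : robustStableSet.eval I.code (fun _ _ => 0) = output.eval I.code
    (chosenLeaves.eval I.code (gapSet.eval I.code (auction.eval I.code (colour.eval I.code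
      (prepare.eval I.code fun _ _ => 0))))) := rfl
  rw [heval]
  generalize prepare.eval I.code (fun _ _ => 0) = σ₁ at *
  obtain ⟨h₂, hz₂, hcol⟩ := eval_colour h₁ fun v => by rw [hz₁ 4 (by simp)]
  generalize colour.eval I.code σ₁ = σ₂ at *
  obtain ⟨h₃, h₄, hinv, hfree⟩ := eval_auction h₂
    (fun v => by rw [hz₂ 6 (by simp), hz₁ 6 (by simp)])
    (fun v => by rw [hz₂ 7 (by simp), hz₁ 7 (by simp)])
  rw [← h₄] at hinv hfree hcol
  generalize auction.eval I.code σ₂ = σ₃ at *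
  obtain ⟨h₅, K, hK0, hKn, hgap, hset⟩ := eval_gapSet h₃
  generalize gapSet.eval I.code σ₃ = σ₄ at *
  have hleaf := eval_chosenLeaves h₅
  have h₆ : Prepared I (chosenLeaves.eval I.code σ₄) := h₅.update (by simp) (by simp) _
  have h12 : chosenLeaves.eval I.code σ₄ 12 = σ₄ 12 := by simp [chosenLeaves, eval]
  generalize chosenLeaves.eval I.code σ₄ = σ₅ at *
  have hout := eval_output h₆
  have hsize : output.eval I.code σ₅ 1 0 = I.n := by simp [output, eval, h₆.size]
  simp only [hleaf] at hout
  by_cases hgood : ∀ v : Fin I.n, IsChosenLeaf I.graph v ∨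
      ∃! u : Fin I.n, I.graph.Adj v u ∧ IsChosenLeaf I.graph u
  · simp only [if_pos hgood] at hout
    have := isRepairableMaximumStable_of_isChosenLeaf (G := I.graph)
      (S := Finset.univ.filter (IsChosenLeaf I.graph)) (by simp)
      (fun v hv => by simpa using (hgood v).resolve_left (by simpa using hv))
    exact ⟨_, this.1, fun _ => by convert this.2, hsize, fun v => by rw [hout, hleaf]; simp⟩
  · simp only [if_neg hgood] at hout
    refine ⟨Finset.univ.filter fun v => σ₄ 12 v ≠ 0, ?_, ?_, hsize, fun v => by
      rw [hout, h12]; simp⟩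
    · refine isMaximumIndepSet_of_labels (fun v => σ₃ 4 v = 1) (fun v => σ₃ 6 v)
        (fun y x => σ₃ 7 y = x + 1) K hK0 hcol hinv.adj (fun y x x' h h' => ?_) hinv.inj
        hinv.exists_of_pos hinv.label_le (fun x hx hxm y hxy => ?_) hgap (fun v => ?_)
      · exact Fin.ext (by omega)
      · have := hfree x hx hxm y hxy
        have := hKn (Nat.pos_of_ne_zero fun h => by have := x.2; omega)
        omega
      · rw [Finset.mem_filter, hset]; simp
    · rintro ⟨T, hT⟩
      exact absurd (fun v => or_iff_not_imp_left.2
        (hT.existsUnique_isChosenLeaf I.bipartite v)) hgood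

end ArrayProgram

theorem theorem5p1 :
    (∀ (V : Type*) [Fintype V] [DecidableEq V] (G : SimpleGraph V), G.IsBipartite →
      ∀ S : Finset V, G.IsMaximumIndepSet S →
        (IsRepairable (IsStable G) S ∨ ¬ ∃ T : Finset V, IsRepairableMaximumStable G T) →
          IsRobustOptimal (IsStable G) S) ∧
    PolyTimeSolvable (β := fun I : BipartiteInstance => Finset (Fin I.n))
      BipartiteInstance.code (fun _ S => vertexSetCode S)
      (fun I S => IsRobustOptimal (IsStable I.graph) S ∧ I.graph.IsMaximumIndepSet S ∧
        ((∃ T : Finset (Fin I.n), IsRepairableMaximumStable I.graph T) →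
          IsRepairable (IsStable I.graph) S)) := by
  refine ⟨fun V _ _ G _ S hS h => isRobustOptimal_of_isMaximumIndepSet hS h,
    polyTimeSolvable_of_arrayProgram ArrayProgram.robustStableSet fun I => ?_⟩
  obtain ⟨S, hmax, hrep, hsize, hout⟩ := ArrayProgram.exists_eval_robustStableSet I
  have hlen := I.length_code
  refine ⟨by omega, S, ⟨isRobustOptimal_of_isMaximumIndepSet hmax ?_, hmax, hrep⟩, ?_, ?_, ?_⟩
  · exact (em _).imp_left hrep
  · simp [vertexSetCode]; omega
  · simp [vertexSetCode, hsize]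
  · intro i hi
    have hi' : i < I.n := by simpa [vertexSetCode] using hi
    simpa [vertexSetCode] using hout ⟨i, hi'⟩
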